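/- Let $n\in\{2,3\}$, let $\Omega\subset\mathbb R^n$ be a bounded Lipschitz domain (in particular, any bounded polygonal or polyhedral Lipschitz domain), and let $\mathcal T$ be a mesh on $\Omega$: finitely many pairwise disjoint open Lipschitz elements $T\subset\Omega$ with $\bar\Omega=\bigcup_{T\in\mathcal T}\bar T$. Let $d>0$ be such that the Poincaré–Friedrichs inequality $\|v\|\le d\,\|\nabla v\|$ holds for all $v\in H^1_0(\Omega)$, where $\|\cdot\|$ is the $L_2(\Omega)$-norm, and let $f\in L_2(\Omega)$. *Spaces.* Let $H^1(\mathcal T)=\prod_{T} H^1(T)$, $H(\mathrm{div};\mathcal T)=\prod_{T} H(\mathrm{div};T)$, $V=H^1(\mathcal T)\times H(\mathrm{div};\mathcal T)$, and let $(\cdot,\cdot)_{\mathcal T}=\sum_T(\cdot,\cdot)_{L_2(T)}$, with differential operators applied elementwise. Define $\mathrm{tr}\colon H^1(\Omega)\to H(\mathrm{div};\mathcal T)'$ and $\mathrm{tr}^{\mathrm{div}}\colon H(\mathrm{div};\Omega)\to H^1(\mathcal T)'$ by $$\langle \mathrm{tr}(v),\tau\rangle_{\mathcal S}=(v,\mathrm{div}\,\tau)_{\mathcal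 T}+(\nabla v,\tau)_{\mathcal T},\qquad \langle \mathrm{tr}^{\mathrm{div}}(\tau),v\rangle_{\mathcal S}=(\tau,\nabla v)_{\mathcal T}+(\mathrm{div}\,\tau,v)_{\mathcal T},$$ and put $U=L_2(\Omega)\times L_2(\Omega)^n\times \mathrm{tr}(H^1_0(\Omega))\times \mathrm{tr}^{\mathrm{div}}(H(\mathrm{div};\Omega))$. *Norms.* For $\boldsymbol u=(u,\sigma,\hat u,\hat\sigma)\in U$ let $$\|\boldsymbol u\|_{U,d}^2=d^{-2}\|u\|^2+\|\sigma\|^2+\inf_{v\in H^1(\Omega),\ \mathrm{tr}(v)=\hat u}\bigl(d^{-2}\|v\|^2+\|\nabla v\|^2\bigr)+\inf_{\tau\in H(\mathrm{div};\Omega),\ \mathrm{tr}^{\mathrm{div}}(\tau)=\hat\sigma}\bigl(\|\tau\|^2+d^2\|\mathrm{div}\,\tau\|^2\bigr),$$ and equip $V$ with the inner product $$\langle(v,\tau),(w,\rho)\rangle_{V,d}=d^{-2}(v,w)_{\mathcal T}+(\nabla v,\nabla w)_{\mathcal T}+(\tau,\rho)_{\mathcal T}+d^2(\mathrm{div}\,\tau,\mathrm{div}\,\rho)_{\mathcal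 T}.$$ *Problem and scheme.* For $\boldsymbol u=(u,\sigma,\hat u,\hat\sigma)\in U$ and $(v,\tau)\in V$ let $$b(\boldsymbol u,(v,\tau))=(u,\mathrm{div}\,\tau)_{\mathcal T}+(\sigma,\tau+\nabla v)_{\mathcal T}-\langle\hat u,\tau\rangle_{\mathcal S}-\langle\hat\sigma,v\rangle_{\mathcal S},\qquad L(v,\tau)=(f,v)_{\mathcal T}.$$ The ultraweak formulation of the Poisson problem is: find $\boldsymbol u\in U$ with $b(\boldsymbol u,\boldsymbol v)=L(\boldsymbol v)$ for all $\boldsymbol v\in V$. The trial-to-test operator $\Theta_d\colon U\to V$ is defined by $\langle\Theta_d\boldsymbol w,\boldsymbol v\rangle_{V,d}=b(\boldsymbol w,\boldsymbol v)$ for all $\boldsymbol v\in V$. Given a finite-dimensional subspace $U_h\subset U$, the DPG scheme is: find $\boldsymbol u_h\in U_h$ with $b(\boldsymbol u_h,\boldsymbol v)=L(\boldsymbol v)$ for all $\boldsymbol v\in\Theta_d(U_h)$. *Claim.* The operator $\Theta_d$ is well defined (each $\boldsymbol w\in U$ has exactly one $\Theta_d\boldsymbol w\in V$), the ultraweak formulation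 has a unique solution $\boldsymbol u=(u,\sigma,\hat u,\hat\sigma)\in U$, the DPG scheme has a unique solution $\boldsymbol u_h=(u_h,\sigma_h,\hat u_h,\hat\sigma_h)\in U_h$, and $$\bigl(d^{-2}\|u-u_h\|^2+\|\sigma-\sigma_h\|^2\bigr)^{1/2}\le 3\sqrt2\,\inf\{\|\boldsymbol u-\boldsymbol w\|_{U,d};\ \boldsymbol w\in U_h\}.$$ -/

import Mathlib

open MeasureTheory Set
open scoped ContDiff NNReal

noncomputable section

namespace DPG

/-! ### Lipschitz sets and meshes -/

/-- Euclidean space `ℝⁿ`. -/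
abbrev Eu (n : ℕ) : Type := EuclideanSpace ℝ (Fin n)

variable {n : ℕ}

/-- `D` is an open set with Lipschitz boundary: near each boundary point, and in suitable Cartesian
coordinates (the last axis pointing in the direction of the unit vector `e`), `D` is the set of
points strictly above the graph of a Lipschitz function of the remaining coordinates (these are
given by the orthogonal projection `y - ⟪e, y⟫ e` of `y`). -/
def IsLipschitzOpen (D : Set (Eu n)) : Prop :=
  IsOpen D ∧ ∀ x ∈ frontier D, ∃ (e : Eu n) (r : ℝ) (K : ℝ≥0) (φ : Eu n → ℝ),
    ‖e‖ = 1 ∧ 0 < r ∧ LipschitzWith K φ ∧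
      ∀ y ∈ Metric.ball x r, y ∈ D ↔ φ (y - (inner ℝ e y) • e) < inner ℝ e y

/-- A bounded Lipschitz domain. -/
structure IsBoundedLipschitzDomain (Ω : Set (Eu n)) : Prop where
  lipschitz : IsLipschitzOpen Ω
  connected : IsConnected Ω
  bounded : Bornology.IsBounded Ω

/-- A mesh on `Ω`: finitely many pairwise disjoint open Lipschitz elements contained in `Ω` whose
closures cover the closure of `Ω`. -/
structure Mesh (Ω : Set (Eu n)) where
  /-- the number of elements -/
  N : ℕ
  /-- the elements -/
  T : Fin N → Set (Eu n)
  lipschitz : ∀ i, IsLipschitzOpen (T i)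
  subset : ∀ i, T i ⊆ Ω
  disjoint : ∀ i j, i ≠ j → Disjoint (T i) (T j)
  cover : closure Ω = ⋃ i, closure (T i)

/-! ### Lebesgue and Sobolev spaces -/

/-- Scalar `L₂(D)`; its inner product and norm are the standard ones. -/
abbrev L2 (D : Set (Eu n)) := Lp ℝ 2 (volume.restrict D)

/-- Vector-valued `L₂(D)ⁿ`; its inner product and norm are the standard ones. -/
abbrev L2v (D : Set (Eu n)) := Lp (Eu n) 2 (volume.restrict D)

/-- `φ ∈ C_c^∞(D)`. -/
structure IsTest (D : Set (Eu n)) (φ : Eu n → ℝ) : Prop where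
  smooth : ContDiff ℝ ∞ φ
  compact : HasCompactSupport φ
  subset : tsupport φ ⊆ D

/-- `g` is the weak gradient of `v` on `D`. -/
def HasWeakGrad (D : Set (Eu n)) (v : L2 D) (g : L2v D) : Prop :=
  ∀ φ, IsTest D φ → ∀ i, ∫ x in D, v x * (gradient φ x) i = - ∫ x in D, (g x) i * φ x

/-- `q` is the weak divergence of `τ` on `D`. -/
def HasWeakDiv (D : Set (Eu n)) (τ : L2v D) (q : L2 D) : Prop :=
  ∀ φ, IsTest D φ → ∫ x in D, inner ℝ (τ x) (gradient φ x) = - ∫ x in D, q x * φ x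

theorem IsTest.continuous_gradient {D : Set (Eu n)} {φ : Eu n → ℝ} (h : IsTest D φ) :
    Continuous (gradient φ) :=
  (InnerProductSpace.toDual ℝ (Eu n)).symm.continuous.comp
    (h.smooth.continuous_fderiv (by simp))

theorem support_gradient_subset {φ : Eu n → ℝ} :
    Function.support (gradient φ) ⊆ tsupport φ := by
  intro x hx
  refine support_fderiv_subset ℝ (f := φ) ?_
  intro h0
  exact hx (by simp [gradient, h0])

theorem IsTest.memLp {D : Set (Eu n)} {φ : Eu n → ℝ} (h : IsTest D φ) :
    MemLp φ 2 (volume.restrict D) :=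
  (h.smooth.continuous.memLp_of_hasCompactSupport h.compact).restrict D

theorem IsTest.memLp_gradient {D : Set (Eu n)} {φ : Eu n → ℝ} (h : IsTest D φ) :
    MemLp (gradient φ) 2 (volume.restrict D) :=
  (h.continuous_gradient.memLp_of_hasCompactSupport
    (h.compact.mono' support_gradient_subset)).restrict D

theorem memLp_coord {μ : Measure (Eu n)} {g : Eu n → Eu n} (h : MemLp g 2 μ) (i : Fin n) :
    MemLp (fun x => g x i) 2 μ :=
  (EuclideanSpace.proj i : Eu n →L[ℝ] ℝ).comp_memLp' h

theorem IsTest.add {D : Set (Eu n)} {φ ψ : Eu n → ℝ} (h : IsTest D φ) (k : IsTest D ψ) :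
    IsTest D (φ + ψ) :=
  ⟨h.smooth.add k.smooth, h.compact.add k.compact,
    (tsupport_add φ ψ).trans (union_subset h.subset k.subset)⟩

theorem IsTest.smul {D : Set (Eu n)} {φ : Eu n → ℝ} (c : ℝ) (h : IsTest D φ) :
    IsTest D (c • φ) :=
  ⟨h.smooth.const_smul c, h.compact.smul_left (f := fun _ => c),
    (closure_mono (Function.support_const_smul_subset c φ)).trans h.subset⟩

theorem gradient_add' {φ ψ : Eu n → ℝ} (h : ContDiff ℝ ∞ φ) (k : ContDiff ℝ ∞ ψ) (x : Eu n) :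
    gradient (φ + ψ) x = gradient φ x + gradient ψ x := by
  unfold gradient
  rw [fderiv_add (h.differentiable (by simp) x) (k.differentiable (by simp) x), map_add]

theorem gradient_smul' {φ : Eu n → ℝ} (c : ℝ) (h : ContDiff ℝ ∞ φ) (x : Eu n) :
    gradient (c • φ) x = c • gradient φ x := by
  unfold gradient
  rw [fderiv_const_smul (h.differentiable (by simp) x)]
  simp

theorem integrable_inner' {μ : Measure (Eu n)} (f : Lp (Eu n) 2 μ) {g : Eu n → Eu n}
    (hg : MemLp g 2 μ) : Integrable (fun x => inner ℝ (f x) (g x)) μ := by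
  refine (L2.integrable_inner (𝕜 := ℝ) f (hg.toLp g)).congr ?_
  filter_upwards [hg.coeFn_toLp] with x hx
  rw [hx]

theorem integrable_mul' {μ : Measure (Eu n)} {f g : Eu n → ℝ} (hf : MemLp f 2 μ)
    (hg : MemLp g 2 μ) : Integrable (fun x => f x * g x) μ :=
  hf.integrable_mul hg

/-- The Sobolev space `H¹(D)`, as the space of pairs `(v, ∇v) ∈ L₂(D) × L₂(D)ⁿ` (the weak gradient
is determined by `v`). -/
def H1 (D : Set (Eu n)) : Submodule ℝ (L2 D × L2v D) where
  carrier := {p | HasWeakGrad D p.1 p.2}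
  zero_mem' := by
    intro φ hφ i
    have h1 : ∫ x in D, ((0 : L2 D) x) * (gradient φ x) i = ∫ x in D, (0 : ℝ) := by
      refine integral_congr_ae ?_
      filter_upwards [Lp.coeFn_zero ℝ 2 (volume.restrict D)] with x hx
      rw [hx]; simp
    have h2 : ∫ x in D, ((0 : L2v D) x) i * φ x = ∫ x in D, (0 : ℝ) := by
      refine integral_congr_ae ?_
      filter_upwards [Lp.coeFn_zero (Eu n) 2 (volume.restrict D)] with x hx
      rw [hx]; simp
    simp only [Prod.fst_zero, Prod.snd_zero]
    rw [h1, h2]; simp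
  add_mem' := by
    intro p q hp hq φ hφ i
    have h1 : ∫ x in D, (p.1 + q.1) x * (gradient φ x) i
        = ∫ x in D, (p.1 x * (gradient φ x) i + q.1 x * (gradient φ x) i) := by
      refine integral_congr_ae ?_
      filter_upwards [Lp.coeFn_add p.1 q.1] with x hx
      rw [hx]; simp [add_mul]
    have h2 : ∫ x in D, ((p.2 + q.2) x) i * φ x
        = ∫ x in D, ((p.2 x) i * φ x + (q.2 x) i * φ x) := by
      refine integral_congr_ae ?_
      filter_upwards [Lp.coeFn_add p.2 q.2] with x hx
      rw [hx]; simp [add_mul]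
    have hg := memLp_coord hφ.memLp_gradient i
    simp only [Prod.fst_add, Prod.snd_add]
    rw [h1, h2, integral_add (integrable_mul' (Lp.memLp p.1) hg)
        (integrable_mul' (Lp.memLp q.1) hg),
      integral_add (integrable_mul' (memLp_coord (Lp.memLp p.2) i) hφ.memLp)
        (integrable_mul' (memLp_coord (Lp.memLp q.2) i) hφ.memLp), hp φ hφ i, hq φ hφ i]
    ring
  smul_mem' := by
    intro c p hp φ hφ i
    have h1 : ∫ x in D, (c • p.1) x * (gradient φ x) i
        = ∫ x in D, c * (p.1 x * (gradient φ x) i) := by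
      refine integral_congr_ae ?_
      filter_upwards [Lp.coeFn_smul c p.1] with x hx
      rw [hx]; simp [mul_assoc]
    have h2 : ∫ x in D, ((c • p.2) x) i * φ x = ∫ x in D, c * ((p.2 x) i * φ x) := by
      refine integral_congr_ae ?_
      filter_upwards [Lp.coeFn_smul c p.2] with x hx
      rw [hx]; simp [mul_assoc]
    simp only [Prod.smul_fst, Prod.smul_snd]
    rw [h1, h2, integral_const_mul, integral_const_mul, hp φ hφ i]
    ring

/-- The space `H(div; D)`, as the space of pairs `(τ, div τ) ∈ L₂(D)ⁿ × L₂(D)` (the weak divergence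
is determined by `τ`). -/
def Hdiv (D : Set (Eu n)) : Submodule ℝ (L2v D × L2 D) where
  carrier := {p | HasWeakDiv D p.1 p.2}
  zero_mem' := by
    intro φ hφ
    have h1 : ∫ x in D, inner ℝ ((0 : L2v D) x) (gradient φ x) = ∫ x in D, (0 : ℝ) := by
      refine integral_congr_ae ?_
      filter_upwards [Lp.coeFn_zero (Eu n) 2 (volume.restrict D)] with x hx
      rw [hx]; simp
    have h2 : ∫ x in D, ((0 : L2 D) x) * φ x = ∫ x in D, (0 : ℝ) := by
      refine integral_congr_ae ?_
      filter_upwards [Lp.coeFn_zero ℝ 2 (volume.restrict D)] with x hx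
      rw [hx]; simp
    simp only [Prod.fst_zero, Prod.snd_zero]
    rw [h1, h2]; simp
  add_mem' := by
    intro p q hp hq φ hφ
    have h1 : ∫ x in D, inner ℝ ((p.1 + q.1) x) (gradient φ x)
        = ∫ x in D, (inner ℝ (p.1 x) (gradient φ x) + inner ℝ (q.1 x) (gradient φ x)) := by
      refine integral_congr_ae ?_
      filter_upwards [Lp.coeFn_add p.1 q.1] with x hx
      rw [hx]; simp
    have h2 : ∫ x in D, (p.2 + q.2) x * φ x = ∫ x in D, (p.2 x * φ x + q.2 x * φ x) := by
      refine integral_congr_ae ?_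
      filter_upwards [Lp.coeFn_add p.2 q.2] with x hx
      rw [hx]; simp [add_mul]
    simp only [Prod.fst_add, Prod.snd_add]
    rw [h1, h2, integral_add (integrable_inner' p.1 hφ.memLp_gradient)
        (integrable_inner' q.1 hφ.memLp_gradient),
      integral_add (integrable_mul' (Lp.memLp p.2) hφ.memLp)
        (integrable_mul' (Lp.memLp q.2) hφ.memLp), hp φ hφ, hq φ hφ]
    ring
  smul_mem' := by
    intro c p hp φ hφ
    have h1 : ∫ x in D, inner ℝ ((c • p.1) x) (gradient φ x)
        = ∫ x in D, c * inner ℝ (p.1 x) (gradient φ x) := by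
      refine integral_congr_ae ?_
      filter_upwards [Lp.coeFn_smul c p.1] with x hx
      rw [hx]; simp
    have h2 : ∫ x in D, (c • p.2) x * φ x = ∫ x in D, c * (p.2 x * φ x) := by
      refine integral_congr_ae ?_
      filter_upwards [Lp.coeFn_smul c p.2] with x hx
      rw [hx]; simp [mul_assoc]
    simp only [Prod.smul_fst, Prod.smul_snd]
    rw [h1, h2, integral_const_mul, integral_const_mul, hp φ hφ]
    ring

variable {D Ω : Set (Eu n)}

/-- The underlying function of an element of `H¹(D)`. -/
def H1.fn : H1 D →ₗ[ℝ] L2 D := LinearMap.fst ℝ _ _ ∘ₗ (H1 D).subtype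

/-- The weak gradient of an element of `H¹(D)`. -/
def H1.grad : H1 D →ₗ[ℝ] L2v D := LinearMap.snd ℝ _ _ ∘ₗ (H1 D).subtype

/-- The underlying vector field of an element of `H(div; D)`. -/
def Hdiv.fn : Hdiv D →ₗ[ℝ] L2v D := LinearMap.fst ℝ _ _ ∘ₗ (Hdiv D).subtype

/-- The weak divergence of an element of `H(div; D)`. -/
def Hdiv.div : Hdiv D →ₗ[ℝ] L2 D := LinearMap.snd ℝ _ _ ∘ₗ (Hdiv D).subtype

/-- The elements of `H¹(D)` that are given by functions in `C_c^∞(D)`. -/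
def H1test (D : Set (Eu n)) : Submodule ℝ (H1 D) where
  carrier := {p | ∃ φ, IsTest D φ ∧ H1.fn p =ᵐ[volume.restrict D] φ ∧
    H1.grad p =ᵐ[volume.restrict D] gradient φ}
  zero_mem' := by
    refine ⟨0, ⟨contDiff_const, HasCompactSupport.zero, by simp [tsupport]⟩, ?_, ?_⟩
    · rw [map_zero]; exact Lp.coeFn_zero ℝ 2 _
    · rw [map_zero]
      refine (Lp.coeFn_zero (Eu n) 2 _).trans (Filter.Eventually.of_forall fun x => ?_)
      simp [gradient]
  add_mem' := by
    rintro p q ⟨φ, hφ, h1, h2⟩ ⟨ψ, hψ, k1, k2⟩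
    refine ⟨φ + ψ, hφ.add hψ, ?_, ?_⟩
    · rw [map_add]; exact (Lp.coeFn_add _ _).trans (h1.add k1)
    · rw [map_add]
      refine (Lp.coeFn_add _ _).trans ?_
      filter_upwards [h2, k2] with x hx kx
      rw [Pi.add_apply, hx, kx, gradient_add' hφ.smooth hψ.smooth]
  smul_mem' := by
    rintro c p ⟨φ, hφ, h1, h2⟩
    refine ⟨c • φ, hφ.smul c, ?_, ?_⟩
    · rw [map_smul]; exact (Lp.coeFn_smul _ _).trans (h1.const_smul c)
    · rw [map_smul]
      refine (Lp.coeFn_smul _ _).trans ?_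
      filter_upwards [h2] with x hx
      rw [Pi.smul_apply, hx, gradient_smul' c hφ.smooth]

/-- `H¹₀(D)`: the closure of `C_c^∞(D)` in `H¹(D)`. -/
def H10 (D : Set (Eu n)) : Submodule ℝ (H1 D) := (H1test D).topologicalClosure

/-- The Poincaré--Friedrichs inequality on `Ω` with constant `d`. -/
def PoincareFriedrichs (Ω : Set (Eu n)) (d : ℝ) : Prop :=
  ∀ v ∈ H10 Ω, ‖H1.fn v‖ ≤ d * ‖H1.grad v‖

/-! ### Restriction to elements and product spaces -/

/-- Restriction `L₂(Ω) → L₂(D)` for `D ⊆ Ω`. -/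
def restrL2 {F : Type*} [NormedAddCommGroup F] [NormedSpace ℝ F] (h : D ⊆ Ω) :
    Lp F 2 (volume.restrict Ω) →ₗ[ℝ] Lp F 2 (volume.restrict D) where
  toFun f := ((Lp.memLp f).mono_measure (Measure.restrict_mono h le_rfl)).toLp f
  map_add' f g := by
    rw [← MemLp.toLp_add]
    exact MemLp.toLp_congr _ _ (ae_mono (Measure.restrict_mono h le_rfl) (Lp.coeFn_add f g))
  map_smul' c f := by
    rw [RingHom.id_apply, ← MemLp.toLp_const_smul]
    exact MemLp.toLp_congr _ _ (ae_mono (Measure.restrict_mono h le_rfl) (Lp.coeFn_smul c f))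

theorem coeFn_restrL2 {F : Type*} [NormedAddCommGroup F] [NormedSpace ℝ F] (h : D ⊆ Ω)
    (f : Lp F 2 (volume.restrict Ω)) : restrL2 h f =ᵐ[volume.restrict D] f :=
  MemLp.coeFn_toLp ((Lp.memLp f).mono_measure (Measure.restrict_mono h le_rfl))

theorem integral_restr (hΩ : IsOpen Ω) (h : D ⊆ Ω) {F G : Eu n → ℝ}
    (hFG : F =ᵐ[volume.restrict D] G) (h0 : ∀ x, x ∉ D → G x = 0) :
    ∫ x in D, F x = ∫ x in Ω, G x := by
  rw [integral_congr_ae hFG]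
  exact (setIntegral_eq_of_subset_of_forall_sdiff_eq_zero hΩ.measurableSet h
    fun x hx => h0 x hx.2).symm

theorem IsTest.mono {φ : Eu n → ℝ} (h : D ⊆ Ω) (hφ : IsTest D φ) : IsTest Ω φ :=
  ⟨hφ.smooth, hφ.compact, hφ.subset.trans h⟩

theorem IsTest.eq_zero {φ : Eu n → ℝ} (hφ : IsTest D φ) {x : Eu n} (hx : x ∉ D) : φ x = 0 :=
  image_eq_zero_of_notMem_tsupport fun h => hx (hφ.subset h)

theorem IsTest.gradient_eq_zero {φ : Eu n → ℝ} (hφ : IsTest D φ) {x : Eu n} (hx : x ∉ D) :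
    gradient φ x = 0 := by
  by_contra h
  exact hx (hφ.subset (support_gradient_subset h))

/-- Restriction `H¹(Ω) → H¹(D)` for `D ⊆ Ω`. -/
def restrH1 (hΩ : IsOpen Ω) (h : D ⊆ Ω) : H1 Ω →ₗ[ℝ] H1 D :=
  LinearMap.codRestrict (H1 D) ((restrL2 h ∘ₗ H1.fn).prod (restrL2 h ∘ₗ H1.grad)) (by
    intro p φ hφ i
    have h1 := coeFn_restrL2 h (H1.fn p)
    have h2 := coeFn_restrL2 h (H1.grad p)
    simp only [LinearMap.prod_apply, Function.prod_apply, LinearMap.comp_apply]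
    rw [integral_restr hΩ h (G := fun x => H1.fn p x * (gradient φ x) i) (by
        filter_upwards [h1] with x hx
        rw [hx]) (by intro x hx; simp [hφ.gradient_eq_zero hx]),
      integral_restr hΩ h (G := fun x => (H1.grad p x) i * φ x) (by
        filter_upwards [h2] with x hx
        rw [hx]) (by intro x hx; simp [hφ.eq_zero hx])]
    exact p.2 φ (hφ.mono h) i)

/-- Restriction `H(div; Ω) → H(div; D)` for `D ⊆ Ω`. -/
def restrHdiv (hΩ : IsOpen Ω) (h : D ⊆ Ω) : Hdiv Ω →ₗ[ℝ] Hdiv D :=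
  LinearMap.codRestrict (Hdiv D) ((restrL2 h ∘ₗ Hdiv.fn).prod (restrL2 h ∘ₗ Hdiv.div)) (by
    intro p φ hφ
    have h1 := coeFn_restrL2 h (Hdiv.fn p)
    have h2 := coeFn_restrL2 h (Hdiv.div p)
    simp only [LinearMap.prod_apply, Function.prod_apply, LinearMap.comp_apply]
    rw [integral_restr hΩ h (G := fun x => inner ℝ (Hdiv.fn p x) (gradient φ x)) (by
        filter_upwards [h1] with x hx
        rw [hx]) (by intro x hx; simp [hφ.gradient_eq_zero hx]),
      integral_restr hΩ h (G := fun x => (Hdiv.div p x) * φ x) (by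
        filter_upwards [h2] with x hx
        rw [hx]) (by intro x hx; simp [hφ.eq_zero hx])]
    exact p.2 φ (hφ.mono h))

/-- `H¹(𝒯)`, the product of the spaces `H¹(T)`. -/
abbrev H1T (M : Mesh Ω) := ∀ i, H1 (M.T i)

/-- `H(div; 𝒯)`, the product of the spaces `H(div; T)`. -/
abbrev HdivT (M : Mesh Ω) := ∀ i, Hdiv (M.T i)

/-- Piecewise restriction `H¹(Ω) → H¹(𝒯)`. -/
def toH1T (hΩ : IsOpen Ω) (M : Mesh Ω) : H1 Ω →ₗ[ℝ] H1T M :=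
  LinearMap.pi fun i => restrH1 hΩ (M.subset i)

/-- Piecewise restriction `H(div; Ω) → H(div; 𝒯)`. -/
def toHdivT (hΩ : IsOpen Ω) (M : Mesh Ω) : Hdiv Ω →ₗ[ℝ] HdivT M :=
  LinearMap.pi fun i => restrHdiv hΩ (M.subset i)

/-! ### Trace operators and trace spaces -/

/-- The local trace of `H¹(D)`: `⟨tr v, τ⟩ = (v, div τ)_D + (∇v, τ)_D`. -/
def trGradLoc (D : Set (Eu n)) : H1 D →ₗ[ℝ] Module.Dual ℝ (Hdiv D) :=
  LinearMap.mk₂ ℝ (fun v τ => inner ℝ (H1.fn v) (Hdiv.div τ) + inner ℝ (H1.grad v) (Hdiv.fn τ))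
    (by intro v w τ; simp only [map_add, inner_add_left]; ring)
    (by intro c v τ; simp only [map_smul, real_inner_smul_left, smul_eq_mul]; ring)
    (by intro v τ ρ; simp only [map_add, inner_add_right]; ring)
    (by intro c v τ; simp only [map_smul, real_inner_smul_right, smul_eq_mul]; ring)

/-- The local trace of `H(div; D)`: `⟨tr τ, v⟩ = (τ, ∇v)_D + (div τ, v)_D`. -/
def trDivLoc (D : Set (Eu n)) : Hdiv D →ₗ[ℝ] Module.Dual ℝ (H1 D) :=
  LinearMap.mk₂ ℝ (fun τ v => inner ℝ (Hdiv.fn τ) (H1.grad v) + inner ℝ (Hdiv.div τ) (H1.fn v))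
    (by intro v w τ; simp only [map_add, inner_add_left]; ring)
    (by intro c v τ; simp only [map_smul, real_inner_smul_left, smul_eq_mul]; ring)
    (by intro v τ ρ; simp only [map_add, inner_add_right]; ring)
    (by intro c v τ; simp only [map_smul, real_inner_smul_right, smul_eq_mul]; ring)

/-- The trace operator on `H¹(𝒯)`: `⟨tr v, τ⟩ = ∑_T ⟨tr_T v, τ⟩`. -/
def trGrad (M : Mesh Ω) : H1T M →ₗ[ℝ] Module.Dual ℝ (HdivT M) :=
  ∑ i, (LinearMap.lcomp ℝ ℝ (LinearMap.proj i : HdivT M →ₗ[ℝ] Hdiv (M.T i))) ∘ₗ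
    trGradLoc (M.T i) ∘ₗ (LinearMap.proj i : H1T M →ₗ[ℝ] H1 (M.T i))

/-- The trace operator on `H(div; 𝒯)`: `⟨tr τ, v⟩ = ∑_T ⟨tr_T τ, v⟩`. -/
def trDiv (M : Mesh Ω) : HdivT M →ₗ[ℝ] Module.Dual ℝ (H1T M) :=
  ∑ i, (LinearMap.lcomp ℝ ℝ (LinearMap.proj i : H1T M →ₗ[ℝ] H1 (M.T i))) ∘ₗ
    trDivLoc (M.T i) ∘ₗ (LinearMap.proj i : HdivT M →ₗ[ℝ] Hdiv (M.T i))

theorem trGrad_apply (M : Mesh Ω) (v : H1T M) (τ : HdivT M) :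
    trGrad M v τ = ∑ i, (inner ℝ (H1.fn (v i)) (Hdiv.div (τ i))
      + inner ℝ (H1.grad (v i)) (Hdiv.fn (τ i))) := by
  simp [trGrad, trGradLoc]

theorem trDiv_apply (M : Mesh Ω) (τ : HdivT M) (v : H1T M) :
    trDiv M τ v = ∑ i, (inner ℝ (Hdiv.fn (τ i)) (H1.grad (v i))
      + inner ℝ (Hdiv.div (τ i)) (H1.fn (v i))) := by
  simp [trDiv, trDivLoc]

/-- The trace of `v ∈ H¹(Ω)` on the skeleton. -/
def trGradΩ (hΩ : IsOpen Ω) (M : Mesh Ω) : H1 Ω →ₗ[ℝ] Module.Dual ℝ (HdivT M) :=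
  trGrad M ∘ₗ toH1T hΩ M

/-- The (normal) trace of `τ ∈ H(div; Ω)` on the skeleton. -/
def trDivΩ (hΩ : IsOpen Ω) (M : Mesh Ω) : Hdiv Ω →ₗ[ℝ] Module.Dual ℝ (H1T M) :=
  trDiv M ∘ₗ toHdivT hΩ M

/-- The trace space `tr(H¹₀(Ω))`, as a space of linear functionals on `H(div; 𝒯)`. -/
def HOtrSub (hΩ : IsOpen Ω) (M : Mesh Ω) : Submodule ℝ (Module.Dual ℝ (HdivT M)) :=
  (H10 Ω).map (trGradΩ hΩ M)

/-- The trace space `tr(H(div; Ω))`, as a space of linear functionals on `H¹(𝒯)`. -/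
def HdivtrSub (hΩ : IsOpen Ω) (M : Mesh Ω) : Submodule ℝ (Module.Dual ℝ (H1T M)) :=
  LinearMap.range (trDivΩ hΩ M)

/-- The trace space `tr(H¹₀(Ω))`. -/
def HOtr (hΩ : IsOpen Ω) (M : Mesh Ω) : Type := ↥(HOtrSub hΩ M)

instance (hΩ : IsOpen Ω) (M : Mesh Ω) : AddCommGroup (HOtr hΩ M) :=
  Submodule.addCommGroup (HOtrSub hΩ M)

instance (hΩ : IsOpen Ω) (M : Mesh Ω) : Module ℝ (HOtr hΩ M) :=
  Submodule.module (HOtrSub hΩ M)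

/-- The functional on `H(div; 𝒯)` given by an element of the trace space: `⟨û, ·⟩_𝒮`. -/
def HOtr.toDual {hΩ : IsOpen Ω} {M : Mesh Ω} : HOtr hΩ M →ₗ[ℝ] Module.Dual ℝ (HdivT M) :=
  (HOtrSub hΩ M).subtype

/-- The trace space `tr(H(div; Ω))`. -/
def Hdivtr (hΩ : IsOpen Ω) (M : Mesh Ω) : Type := ↥(HdivtrSub hΩ M)

instance (hΩ : IsOpen Ω) (M : Mesh Ω) : AddCommGroup (Hdivtr hΩ M) :=
  Submodule.addCommGroup (HdivtrSub hΩ M)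

instance (hΩ : IsOpen Ω) (M : Mesh Ω) : Module ℝ (Hdivtr hΩ M) :=
  Submodule.module (HdivtrSub hΩ M)

/-- The functional on `H¹(𝒯)` given by an element of the trace space: `⟨σ̂, ·⟩_𝒮`. -/
def Hdivtr.toDual {hΩ : IsOpen Ω} {M : Mesh Ω} : Hdivtr hΩ M →ₗ[ℝ] Module.Dual ℝ (H1T M) :=
  (HdivtrSub hΩ M).subtype

/-! ### Scaled norms -/

/-- `‖v‖_{1,d,D} = (d⁻² ‖v‖² + ‖∇v‖²)^{1/2}`. -/
def normH1 (d : ℝ) (v : H1 D) : ℝ :=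
  Real.sqrt ((d ^ 2)⁻¹ * ‖H1.fn v‖ ^ 2 + ‖H1.grad v‖ ^ 2)

/-- `‖τ‖_{div,d,D} = (‖τ‖² + d² ‖div τ‖²)^{1/2}`. -/
def normHdiv (d : ℝ) (τ : Hdiv D) : ℝ :=
  Real.sqrt (‖Hdiv.fn τ‖ ^ 2 + d ^ 2 * ‖Hdiv.div τ‖ ^ 2)

/-- The trace norm `‖·‖_{1/2,d,𝒮}`. -/
def normHalf (hΩ : IsOpen Ω) (M : Mesh Ω) (d : ℝ) (vhat : HOtr hΩ M) : ℝ :=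
  sInf {r | ∃ v : H1 Ω, trGradΩ hΩ M v = HOtr.toDual vhat ∧ r = normH1 d v}

/-- The trace norm `‖·‖_{-1/2,d,𝒮}`. -/
def normNegHalf (hΩ : IsOpen Ω) (M : Mesh Ω) (d : ℝ) (τhat : Hdivtr hΩ M) : ℝ :=
  sInf {r | ∃ τ : Hdiv Ω, trDivΩ hΩ M τ = Hdivtr.toDual τhat ∧ r = normHdiv d τ}

/-! ### The ultraweak formulation and the DPG scheme -/

/-- The ansatz space `U`, with elements `(u, σ, û, σ̂)`. -/
abbrev USp (hΩ : IsOpen Ω) (M : Mesh Ω) := L2 Ω × L2v Ω × HOtr hΩ M × Hdivtr hΩ M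

/-- The test space `V = H¹(𝒯) × H(div; 𝒯)`, with elements `(v, τ)`. -/
abbrev VSp (M : Mesh Ω) := H1T M × HdivT M

/-- `‖(u, σ, û, σ̂)‖_{U,d}`. -/
def normU (hΩ : IsOpen Ω) (M : Mesh Ω) (d : ℝ) (u : USp hΩ M) : ℝ :=
  Real.sqrt ((d ^ 2)⁻¹ * ‖u.1‖ ^ 2 + ‖u.2.1‖ ^ 2 + normHalf hΩ M d u.2.2.1 ^ 2
    + normNegHalf hΩ M d u.2.2.2 ^ 2)

/-- The scaled inner product of `V`. -/
def ipV (M : Mesh Ω) (d : ℝ) (v w : VSp M) : ℝ :=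
  ∑ i, ((d ^ 2)⁻¹ * inner ℝ (H1.fn (v.1 i)) (H1.fn (w.1 i))
    + inner ℝ (H1.grad (v.1 i)) (H1.grad (w.1 i))
    + inner ℝ (Hdiv.fn (v.2 i)) (Hdiv.fn (w.2 i))
    + d ^ 2 * inner ℝ (Hdiv.div (v.2 i)) (Hdiv.div (w.2 i)))

/-- The bilinear form
`b(u, v) = (u, div τ + γ v)_𝒯 + (σ, τ + ∇v)_𝒯 - ⟨û, τ⟩_𝒮 - ⟨σ̂, v⟩_𝒮`. -/
def bform (hΩ : IsOpen Ω) (M : Mesh Ω) (γ : ℝ) (u : USp hΩ M) (v : VSp M) : ℝ :=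
  ∑ i, (inner ℝ (restrL2 (M.subset i) u.1) (Hdiv.div (v.2 i) + γ • H1.fn (v.1 i))
    + inner ℝ (restrL2 (M.subset i) u.2.1) (Hdiv.fn (v.2 i) + H1.grad (v.1 i)))
  - HOtr.toDual u.2.2.1 v.2 - Hdivtr.toDual u.2.2.2 v.1

/-- The load functional `L(v) = (f, v)`. -/
def load (M : Mesh Ω) (f : L2 Ω) (v : VSp M) : ℝ :=
  ∑ i, inner ℝ (restrL2 (M.subset i) f) (H1.fn (v.1 i))

/-- `u` solves the ultraweak formulation `b(u, v) = L(v)` for all `v ∈ V`. -/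
def IsUltraweakSolution (hΩ : IsOpen Ω) (M : Mesh Ω) (γ : ℝ) (f : L2 Ω) (u : USp hΩ M) : Prop :=
  ∀ v : VSp M, bform hΩ M γ u v = load M f v

/-- `θ = Θ_d w`: the value of the scaled trial-to-test operator at `w`, that is,
`⟨θ, v⟩_{V,d} = b(w, v)` for all `v ∈ V`. -/
def IsTrialToTest (hΩ : IsOpen Ω) (M : Mesh Ω) (γ d : ℝ) (w : USp hΩ M) (θ : VSp M) : Prop :=
  ∀ v : VSp M, ipV M d θ v = bform hΩ M γ w v

/-- `u_h` solves the DPG scheme: `u_h ∈ U_h` and `b(u_h, v) = L(v)` for all `v ∈ Θ_d(U_h)`. -/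
def IsDPGSolution (hΩ : IsOpen Ω) (M : Mesh Ω) (γ d : ℝ) (f : L2 Ω)
    (Uh : Submodule ℝ (USp hΩ M)) (uh : USp hΩ M) : Prop :=
  uh ∈ Uh ∧ ∀ w ∈ Uh, ∀ θ : VSp M, IsTrialToTest hΩ M γ d w θ →
    bform hΩ M γ uh θ = load M f θ

end DPG

end

noncomputable section

namespace DPG

variable {n : ℕ} {D Ω : Set (Eu n)}

/-! ### Lipschitz boundaries are null sets -/

/-! With optimal test functions the DPG scheme is a Galerkin method in disguise. Embed `V` with its
scaled inner product into a Hilbert space by `testEmb`, and let `A` be the trial-to-test operator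
followed by this embedding. Then `b(w, Θ x) = ⟪A w, A x⟫`, so `u_h` is the best approximation of `u`
in the energy norm `‖A w‖`, which is the dual norm of `b(w, ·)`. It remains to compare this norm
with the two norms of the claim (`abstract_dpg`): `‖A w‖ ≤ √3 ‖w‖_U` by `abs_bform_le`, and the
field norm is at most `√6 ‖A w‖` by `normField_le`. The product of the constants is `3√2`.

Boundedness: once lifts of both traces are chosen, `b(u, ·)` is the inner product with one explicit
element of the Hilbert space (`bform_eq_inner`), and Cauchy–Schwarz applies; then the infimum over
lifts is taken.

Stability: for given fields `(u, σ)` a Poisson problem yields a conforming pair with `τ + ∇v = σ`,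
`div τ = d⁻² u` and `v ∈ H¹₀` (`exists_adjoint`). Global integration by parts kills the skeleton
terms, so `b` tested with this pair is exactly the squared field norm. This also gives injectivity
of `b`, hence uniqueness; existence comes from the weak solution of the Poisson problem
(`exists_ultraweak`). Passing from elements to `Ω` requires that element boundaries are null sets.
-/

/-- The graph of a continuous function over a hyperplane is a null set. -/
theorem volume_graph_eq_zero (e : Eu n) (he : ‖e‖ = 1) {φ : Eu n → ℝ} (hφ : Continuous φ) :
    volume {y : Eu n | φ (y - (inner ℝ e y) • e) = inner ℝ e y} = 0 := by
  -- The translates of the graph along `e` are uncountably many disjoint measurable sets of equal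
  -- measure; only countably many of them can have positive measure.
  set G : ℝ → Set (Eu n) := fun t => {y | φ (y - (inner ℝ e y) • e) + t = inner ℝ e y} with hG
  have hmeas : ∀ t, MeasurableSet (G t) := fun t =>
    (isClosed_eq (by fun_prop) (by fun_prop)).measurableSet
  have hdisj : Pairwise (Function.onFun Disjoint G) := by
    intro s t hst
    refine Set.disjoint_left.2 fun y hs ht => hst ?_
    simp only [hG, mem_ofPred_eq] at hs ht
    linarith
  have hee : inner ℝ e e = (1 : ℝ) := by rw [real_inner_self_eq_norm_sq, he]; norm_num
  have hvol : ∀ t, volume (G t) = volume (G 0) := by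
    intro t
    have : G t = (fun y => y + (-t) • e) ⁻¹' G 0 := by
      ext y
      have h1 : inner ℝ e (y + (-t) • e) = inner ℝ e y - t := by
        rw [inner_add_right, inner_smul_right, hee]; ring
      have h2 : y + (-t) • e - (inner ℝ e y - t) • e = y - (inner ℝ e y) • e := by
        module
      simp only [hG, mem_ofPred_eq, mem_preimage, h1, h2]
      constructor <;> intro h <;> linarith
    rw [this, measure_preimage_add_right]
  have hcount := Measure.countable_meas_pos_of_disjoint_iUnion (μ := volume) hmeas hdisj
  have h0 : volume (G 0) = 0 := by
    by_contra hne
    have huniv : {t | 0 < volume (G t)} = (univ : Set ℝ) := by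
      ext t
      simp [hvol t, pos_iff_ne_zero, hne]
    rw [huniv] at hcount
    exact not_countable_univ hcount
  simpa [hG] using h0

/-- Near a boundary point the frontier lies on the graph: points strictly above it belong to the
open set `D`, and points strictly below it have a neighbourhood that misses `D`. -/
theorem IsLipschitzOpen.volume_frontier (h : IsLipschitzOpen D) : volume (frontier D) = 0 := by
  refine measure_null_of_locally_null _ fun x hx => ?_
  obtain ⟨e, r, K, φ, he, hr, hφ, hD⟩ := h.2 x hx
  refine ⟨frontier D ∩ Metric.ball x r,
    inter_mem_nhdsWithin _ (Metric.ball_mem_nhds x hr), ?_⟩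
  refine measure_mono_null ?_ (volume_graph_eq_zero e he hφ.continuous)
  have hcont := hφ.continuous
  rintro y ⟨hyf, hyb⟩
  rcases lt_trichotomy (φ (y - (inner ℝ e y) • e)) (inner ℝ e y) with hlt | heq | hgt
  · rw [h.1.frontier_eq] at hyf
    exact absurd ((hD y hyb).2 hlt) hyf.2
  · exact heq
  · exfalso
    have ho : IsOpen (Metric.ball x r ∩ {z : Eu n | inner ℝ e z < φ (z - (inner ℝ e z) • e)}) :=
      Metric.isOpen_ball.inter (isOpen_lt (by fun_prop) (by fun_prop))
    obtain ⟨z, ⟨hz1, hz2⟩, hz3⟩ :=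
      mem_closure_iff.1 (frontier_subset_closure hyf) _ ho ⟨hyb, hgt⟩
    exact lt_asymm hz2 ((hD z hz1).1 hz3)

/-- By the covering of the closure, a point of `Ω` outside all elements lies on the boundary of one
of them, and these boundaries are finitely many null sets. -/
theorem Mesh.iUnion_ae_eq (M : Mesh Ω) : (⋃ i, M.T i) =ᵐ[volume] Ω := by
  have hsub : (⋃ i, M.T i) ⊆ Ω := iUnion_subset M.subset
  refine (LE.le.eventuallyLE hsub).antisymm ?_
  refine ae_le_set.2 (measure_mono_null (t := ⋃ i, frontier (M.T i)) ?_
    (measure_iUnion_null fun i => (M.lipschitz i).volume_frontier))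
  rintro x ⟨hx, hxT⟩
  have hxc : x ∈ ⋃ i, closure (M.T i) := M.cover ▸ subset_closure hx
  obtain ⟨i, hi⟩ := mem_iUnion.1 hxc
  refine mem_iUnion.2 ⟨i, ?_⟩
  rw [(M.lipschitz i).1.frontier_eq]
  exact ⟨hi, fun h => hxT (mem_iUnion.2 ⟨i, h⟩)⟩

/-- The `L₂(Ω)` inner product is the sum of the inner products over the elements. -/
theorem sum_inner_restrL2 {F : Type*} [NormedAddCommGroup F] [InnerProductSpace ℝ F]
    (M : Mesh Ω) (f g : Lp F 2 (volume.restrict Ω)) :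
    ∑ i, inner ℝ (restrL2 (M.subset i) f) (restrL2 (M.subset i) g) = inner ℝ f g := by
  have hint : IntegrableOn (fun x => inner ℝ (f x) (g x)) Ω volume :=
    L2.integrable_inner (𝕜 := ℝ) f g
  have h1 : ∀ i, inner ℝ (restrL2 (M.subset i) f) (restrL2 (M.subset i) g)
      = ∫ x in M.T i, inner ℝ (f x) (g x) := by
    intro i
    rw [L2.inner_def]
    refine integral_congr_ae ?_
    filter_upwards [coeFn_restrL2 (M.subset i) f, coeFn_restrL2 (M.subset i) g] with x hx kx
    rw [hx, kx]
  simp only [h1]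
  rw [← integral_iUnion_fintype (fun i => (M.lipschitz i).1.measurableSet)
    (fun i j hij => M.disjoint i j hij) (fun i => hint.mono_set (M.subset i)),
    setIntegral_congr_set M.iUnion_ae_eq, L2.inner_def]

/-! ### Hilbert space tools -/

section Hilbert

variable {H V U : Type*} [NormedAddCommGroup H] [InnerProductSpace ℝ H]
  [AddCommGroup V] [Module ℝ V] [AddCommGroup U] [Module ℝ U]

/-- Riesz representation on a space that is embedded as a closed subspace of a Hilbert space. -/
theorem exists_inner_eq_of_bound [CompleteSpace H] (J : V →ₗ[ℝ] H) (hJ : Function.Injective J)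
    (hc : IsClosed (range J)) (l : V →ₗ[ℝ] ℝ) (C : ℝ) (hl : ∀ v, |l v| ≤ C * ‖J v‖) :
    ∃ θ, ∀ v, inner ℝ (J θ) (J v) = l v := by
  set K : Submodule ℝ H := LinearMap.range J with hK
  have hKc : IsClosed (K : Set H) := by rw [hK, LinearMap.coe_range]; exact hc
  have : CompleteSpace K := hKc.completeSpace_coe
  let E : V ≃ₗ[ℝ] K := LinearEquiv.ofInjective J hJ
  have hE : ∀ v, ((E v : K) : H) = J v := fun v => rfl
  let L : StrongDual ℝ K := LinearMap.mkContinuous (l ∘ₗ E.symm.toLinearMap) C (by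
    intro x
    obtain ⟨v, rfl⟩ := E.surjective x
    have : ‖E v‖ = ‖J v‖ := rfl
    simpa [this] using hl v)
  obtain ⟨θ, hθ⟩ := E.surjective ((InnerProductSpace.toDual ℝ K).symm L)
  refine ⟨θ, fun v => ?_⟩
  have h := InnerProductSpace.toDual_symm_apply (𝕜 := ℝ) (x := E v) (y := L)
  rw [← hθ, Submodule.coe_inner] at h
  rw [← hE, ← hE, h]
  simp [L]

/-- Unique solvability of Galerkin equations for an injective operator and a finite-dimensional
trial space. -/
theorem existsUnique_galerkin (A : U →ₗ[ℝ] H) (hA : Function.Injective A) (Uh : Submodule ℝ U)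
    [FiniteDimensional ℝ Uh] (u : U) :
    ∃! uh, uh ∈ Uh ∧ ∀ w ∈ Uh, inner ℝ (A (u - uh)) (A w) = 0 := by
  -- `uh` is a preimage of the orthogonal projection of `A u` onto the finite-dimensional space
  -- `A(Uh)`; injectivity of `A` makes it unique.
  obtain ⟨uh, huh, hp⟩ := (Submodule.mem_map (f := A)).1
    (Submodule.starProjection_apply_mem (Uh.map A) (A u))
  refine ⟨uh, ⟨huh, fun w hw => ?_⟩, fun y ⟨hy, hyo⟩ => ?_⟩
  · rw [map_sub, hp]
    exact Submodule.starProjection_inner_eq_zero _ _ (Submodule.mem_map_of_mem hw)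
  · refine hA ?_
    rw [hp]
    refine (Submodule.eq_starProjection_of_mem_of_inner_eq_zero
      (Submodule.mem_map_of_mem hy) ?_).symm
    rintro _ ⟨w, hw, rfl⟩
    rw [← map_sub]
    exact hyo w hw

/-- Galerkin approximations are best approximations in the energy norm. -/
theorem norm_sub_le_of_galerkin (A : U →ₗ[ℝ] H) (Uh : Submodule ℝ U) {u uh : U} (huh : uh ∈ Uh)
    (h : ∀ w ∈ Uh, inner ℝ (A (u - uh)) (A w) = 0) {w : U} (hw : w ∈ Uh) :
    ‖A (u - uh)‖ ≤ ‖A (u - w)‖ := by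
  have h1 : A (u - w) = A (u - uh) + A (uh - w) := by rw [← map_add]; congr 1; abel
  have h2 := norm_add_sq_eq_norm_sq_add_norm_sq_real (h _ (Uh.sub_mem huh hw))
  rw [← h1] at h2
  nlinarith [norm_nonneg (A (u - uh)), norm_nonneg (A (u - w)),
    mul_self_nonneg ‖A (uh - w)‖]

end Hilbert

/-! ### Closedness of the Sobolev spaces -/

/-- A test function as an element of `L₂(D)`. -/
def IsTest.toL2 {φ : Eu n → ℝ} (h : IsTest D φ) : L2 D := h.memLp.toLp φ

/-- The gradient of a test function as an element of `L₂(D)ⁿ`. -/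
def IsTest.gradL2 {φ : Eu n → ℝ} (h : IsTest D φ) : L2v D := h.memLp_gradient.toLp (gradient φ)

/-- The `i`-th component of an element of `L₂(D)ⁿ`. -/
def coordL2 (D : Set (Eu n)) (i : Fin n) : L2v D →L[ℝ] L2 D :=
  (EuclideanSpace.proj i : Eu n →L[ℝ] ℝ).compLpL 2 (volume.restrict D)

theorem coeFn_coordL2 (i : Fin n) (g : L2v D) :
    coordL2 D i g =ᵐ[volume.restrict D] fun x => g x i :=
  ContinuousLinearMap.coeFn_compLpL (p := 2) (EuclideanSpace.proj i : Eu n →L[ℝ] ℝ) g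

theorem inner_L2_eq {v w : L2 D} {f g : Eu n → ℝ} (hf : v =ᵐ[volume.restrict D] f)
    (hg : w =ᵐ[volume.restrict D] g) : inner ℝ v w = ∫ x in D, f x * g x := by
  rw [L2.inner_def]
  refine integral_congr_ae ?_
  filter_upwards [hf, hg] with x hx kx
  rw [hx, kx]
  simp [mul_comm]

theorem inner_L2v_eq {v w : L2v D} {f g : Eu n → Eu n} (hf : v =ᵐ[volume.restrict D] f)
    (hg : w =ᵐ[volume.restrict D] g) : inner ℝ v w = ∫ x in D, inner ℝ (f x) (g x) := by
  rw [L2.inner_def]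
  refine integral_congr_ae ?_
  filter_upwards [hf, hg] with x hx kx
  rw [hx, kx]

theorem IsTest.coeFn_toL2 {φ : Eu n → ℝ} (h : IsTest D φ) : h.toL2 =ᵐ[volume.restrict D] φ :=
  MemLp.coeFn_toLp _

theorem IsTest.coeFn_gradL2 {φ : Eu n → ℝ} (h : IsTest D φ) :
    h.gradL2 =ᵐ[volume.restrict D] gradient φ :=
  MemLp.coeFn_toLp _

theorem IsTest.coeFn_coordL2_gradL2 {φ : Eu n → ℝ} (h : IsTest D φ) (i : Fin n) :
    coordL2 D i h.gradL2 =ᵐ[volume.restrict D] fun x => gradient φ x i := by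
  filter_upwards [coeFn_coordL2 i h.gradL2, h.coeFn_gradL2] with x hx kx
  rw [hx, kx]

/-- In this form each test function imposes an equality between continuous functions of `(v, g)`,
which makes `H1 D` closed in `L₂ × L₂ⁿ`. The divergence is treated likewise. -/
theorem hasWeakGrad_iff_inner {v : L2 D} {g : L2v D} : HasWeakGrad D v g ↔
    ∀ φ (h : IsTest D φ) i,
      inner ℝ v (coordL2 D i h.gradL2) = -inner ℝ (coordL2 D i g) h.toL2 := by
  refine forall_congr' fun φ => forall_congr' fun h => forall_congr' fun i => ?_
  rw [inner_L2_eq (Filter.EventuallyEq.refl _ _) (h.coeFn_coordL2_gradL2 i),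
    inner_L2_eq (coeFn_coordL2 i g) h.coeFn_toL2]

theorem hasWeakDiv_iff_inner {τ : L2v D} {q : L2 D} : HasWeakDiv D τ q ↔
    ∀ φ (h : IsTest D φ), inner ℝ τ h.gradL2 = -inner ℝ q h.toL2 := by
  refine forall_congr' fun φ => forall_congr' fun h => ?_
  rw [inner_L2v_eq (Filter.EventuallyEq.refl _ _) h.coeFn_gradL2,
    inner_L2_eq (Filter.EventuallyEq.refl _ _) h.coeFn_toL2]

theorem isClosed_H1 (D : Set (Eu n)) : IsClosed (H1 D : Set (L2 D × L2v D)) := by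
  have : (H1 D : Set (L2 D × L2v D)) = ⋂ (φ) (h : IsTest D φ) (i),
      {p | inner ℝ p.1 (coordL2 D i h.gradL2) = -inner ℝ (coordL2 D i p.2) h.toL2} := by
    ext p
    simp only [mem_iInter]
    exact hasWeakGrad_iff_inner
  rw [this]
  exact isClosed_iInter fun φ => isClosed_iInter fun h => isClosed_iInter fun i =>
    isClosed_eq (by fun_prop) (by fun_prop)

theorem isClosed_Hdiv (D : Set (Eu n)) : IsClosed (Hdiv D : Set (L2v D × L2 D)) := by
  have : (Hdiv D : Set (L2v D × L2 D)) = ⋂ (φ) (h : IsTest D φ),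
      {p | inner ℝ p.1 h.gradL2 = -inner ℝ p.2 h.toL2} := by
    ext p
    simp only [mem_iInter]
    exact hasWeakDiv_iff_inner
  rw [this]
  exact isClosed_iInter fun φ => isClosed_iInter fun h =>
    isClosed_eq (by fun_prop) (by fun_prop)

/-! ### Integration by parts -/

theorem gradient_coord (φ : Eu n → ℝ) (x : Eu n) (i : Fin n) :
    gradient φ x i = fderiv ℝ φ x (EuclideanSpace.single i 1) := by
  rw [← inner_gradient_left, EuclideanSpace.inner_single_right]
  simp

/-- Both factors vanish outside `D`, so integration by parts on the whole space gives the identity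
on `D` without any regularity of its boundary. -/
theorem IsTest.hasWeakGrad {φ : Eu n → ℝ} (h : IsTest D φ) :
    HasWeakGrad D h.toL2 h.gradL2 := by
  intro ψ k i
  have hφ : HasCompactSupport fun x => fderiv ℝ φ x (EuclideanSpace.single i 1) :=
    h.compact.fderiv_apply ℝ _
  have hψ : HasCompactSupport fun x => fderiv ℝ ψ x (EuclideanSpace.single i 1) :=
    k.compact.fderiv_apply ℝ _
  have cφ : Continuous fun x => fderiv ℝ φ x (EuclideanSpace.single i 1) :=
    (h.smooth.continuous_fderiv (by simp)).clm_apply continuous_const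
  have cψ : Continuous fun x => fderiv ℝ ψ x (EuclideanSpace.single i 1) :=
    (k.smooth.continuous_fderiv (by simp)).clm_apply continuous_const
  have key := integral_mul_fderiv_eq_neg_fderiv_mul_of_integrable (μ := volume) (f := φ) (g := ψ)
    (v := EuclideanSpace.single i 1)
    ((cφ.mul k.smooth.continuous).integrable_of_hasCompactSupport hφ.mul_right)
    ((h.smooth.continuous.mul cψ).integrable_of_hasCompactSupport h.compact.mul_right)
    ((h.smooth.continuous.mul k.smooth.continuous).integrable_of_hasCompactSupport
      h.compact.mul_right)
    (fun x _ => h.smooth.differentiable (by simp) x)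
    (fun x _ => k.smooth.differentiable (by simp) x)
  rw [← setIntegral_eq_integral_of_forall_compl_eq_zero (s := D)
      (f := fun x => φ x * fderiv ℝ ψ x (EuclideanSpace.single i 1)) (fun x hx => by
      rw [h.eq_zero hx, zero_mul]),
    ← setIntegral_eq_integral_of_forall_compl_eq_zero (s := D)
      (f := fun x => fderiv ℝ φ x (EuclideanSpace.single i 1) * ψ x) (fun x hx => by
      rw [k.eq_zero hx, mul_zero])] at key
  simp only [← gradient_coord] at key
  have h1 : ∫ x in D, h.toL2 x * gradient ψ x i = ∫ x in D, φ x * gradient ψ x i := by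
    refine integral_congr_ae ?_
    filter_upwards [h.coeFn_toL2] with x hx
    rw [hx]
  have h2 : ∫ x in D, h.gradL2 x i * ψ x = ∫ x in D, gradient φ x i * ψ x := by
    refine integral_congr_ae ?_
    filter_upwards [h.coeFn_gradL2] with x hx
    rw [hx]
  rw [h1, h2, key]

/-- A test function as an element of `H¹(D)`. -/
def IsTest.toH1 {φ : Eu n → ℝ} (h : IsTest D φ) : H1 D := ⟨(h.toL2, h.gradL2), h.hasWeakGrad⟩

theorem IsTest.toH1_mem_H10 {φ : Eu n → ℝ} (h : IsTest D φ) : h.toH1 ∈ H10 D :=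
  Submodule.le_topologicalClosure _ ⟨φ, h, h.coeFn_toL2, h.coeFn_gradL2⟩

theorem H1.continuous_fn : Continuous (H1.fn (D := D)) :=
  continuous_fst.comp continuous_subtype_val

theorem H1.continuous_grad : Continuous (H1.grad (D := D)) :=
  continuous_snd.comp continuous_subtype_val

/-- Integration by parts between `H¹₀(D)` and `H(div; D)`. -/
theorem inner_div_add_inner_grad_eq_zero {v : H1 D} (hv : v ∈ H10 D) (τ : Hdiv D) :
    inner ℝ (H1.fn v) (Hdiv.div τ) + inner ℝ (H1.grad v) (Hdiv.fn τ) = 0 := by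
  -- Density argument: the identity is a closed condition on `v`, and for test functions it is the
  -- definition of the weak divergence.
  have hcl : IsClosed {v : H1 D |
      inner ℝ (H1.fn v) (Hdiv.div τ) + inner ℝ (H1.grad v) (Hdiv.fn τ) = 0} :=
    isClosed_eq ((H1.continuous_fn.inner continuous_const).add
      (H1.continuous_grad.inner continuous_const)) continuous_const
  refine hcl.closure_subset_iff.2 ?_ hv
  rintro p ⟨φ, h, h1, h2⟩
  have e1 : H1.fn p = h.toL2 := Lp.ext (h1.trans h.coeFn_toL2.symm)
  have e2 : H1.grad p = h.gradL2 := Lp.ext (h2.trans h.coeFn_gradL2.symm)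
  have := hasWeakDiv_iff_inner.1 τ.2 φ h
  change _ + _ = _
  rw [e1, e2, real_inner_comm, real_inner_comm _ h.gradL2]
  change inner ℝ (Hdiv.fn τ) h.gradL2 = -inner ℝ (Hdiv.div τ) h.toL2 at this
  linarith

theorem hasWeakDiv_of_forall_H10 {τ : L2v D} {q : L2 D}
    (h : ∀ w ∈ H10 D, inner ℝ τ (H1.grad w) = -inner ℝ q (H1.fn w)) : HasWeakDiv D τ q :=
  hasWeakDiv_iff_inner.2 fun _ hφ => h _ hφ.toH1_mem_H10

/-! ### The Poisson problem -/

/-- A variational problem on a closed subspace of a product of Hilbert spaces, on which the second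
component controls the first one. -/
theorem exists_variational {A H : Type*} [NormedAddCommGroup A] [InnerProductSpace ℝ A]
    [CompleteSpace A] [NormedAddCommGroup H] [InnerProductSpace ℝ H] [CompleteSpace H]
    (S : Submodule ℝ (A × H)) (hS : IsClosed (S : Set (A × H))) (d : ℝ)
    (hd : ∀ p ∈ S, ‖p.1‖ ≤ d * ‖p.2‖) (a : A) (σ : H) :
    ∃ p ∈ S, ∀ q ∈ S, inner ℝ p.2 q.2 = inner ℝ σ q.2 + inner ℝ a q.1 := by
  have : CompleteSpace S := hS.completeSpace_coe
  let G : S →L[ℝ] H := (ContinuousLinearMap.snd ℝ A H).comp S.subtypeL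
  have hG : ∀ p : S, G p = (p : A × H).2 := fun _ => rfl
  -- The product carries the maximum norm, whence the constant `max d 1`. Being bounded below, the
  -- second projection embeds `S` as a closed subspace of `H`, where Riesz representation applies.
  have hanti : AntilipschitzWith (max d 1).toNNReal G := by
    refine AddMonoidHomClass.antilipschitz_of_bound G fun p => ?_
    rw [Real.coe_toNNReal _ (zero_le_one.trans (le_max_right _ _))]
    refine max_le ((hd _ p.2).trans ?_) ?_
    · exact mul_le_mul_of_nonneg_right (le_max_left _ _) (norm_nonneg _)
    · exact le_mul_of_one_le_left (norm_nonneg _) (le_max_right _ _)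
  obtain ⟨p, hp⟩ := exists_inner_eq_of_bound G.toLinearMap hanti.injective
    (hanti.isClosed_range G.uniformContinuous)
    (innerₛₗ ℝ σ ∘ₗ LinearMap.snd ℝ A H ∘ₗ S.subtype
      + innerₛₗ ℝ a ∘ₗ LinearMap.fst ℝ A H ∘ₗ S.subtype) (‖σ‖ + ‖a‖ * d) (by
      intro p
      have h1 := abs_real_inner_le_norm σ (p : A × H).2
      have h2 := abs_real_inner_le_norm a (p : A × H).1
      have h3 := mul_le_mul_of_nonneg_left (hd _ p.2) (norm_nonneg a)
      refine (abs_add_le (inner ℝ σ (p : A × H).2) (inner ℝ a (p : A × H).1)).trans ?_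
      rw [ContinuousLinearMap.coe_coe, hG]
      linarith)
  exact ⟨p, p.2, fun q hq => hp ⟨q, hq⟩⟩

/-- Weak solvability of the Poisson problem with right-hand side `a - div σ`. -/
theorem exists_poisson {d : ℝ} (hPF : PoincareFriedrichs Ω d) (σ : L2v Ω)
    (a : L2 Ω) : ∃ v ∈ H10 Ω, ∀ w ∈ H10 Ω,
      inner ℝ (H1.grad v) (H1.grad w) = inner ℝ σ (H1.grad w) + inner ℝ a (H1.fn w) := by
  have hcl : IsClosed ((H10 Ω).map (H1 Ω).subtype : Set (L2 Ω × L2v Ω)) :=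
    (isClosed_H1 Ω).isClosedEmbedding_subtypeVal.isClosedMap _
      (Submodule.isClosed_topologicalClosure _)
  have hb : ∀ p ∈ (H10 Ω).map (H1 Ω).subtype, ‖p.1‖ ≤ d * ‖p.2‖ := by
    rintro _ ⟨v, hv, rfl⟩
    exact hPF v hv
  obtain ⟨_, ⟨v, hv, rfl⟩, h⟩ := exists_variational _ hcl d hb a σ
  exact ⟨v, hv, fun w hw => h _ ⟨w, hw, rfl⟩⟩

/-! ### The scaled embedding of a product space into a Hilbert space -/

section Embedding

variable {ι : Type*} {X Y : ι → Type*}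
  [∀ i, NormedAddCommGroup (X i)] [∀ i, InnerProductSpace ℝ (X i)]
  [∀ i, NormedAddCommGroup (Y i)] [∀ i, InnerProductSpace ℝ (Y i)]

/-- The Hilbert sum of the spaces `X i × Y i × Y i × X i`. -/
abbrev SumHilbert (X Y : ι → Type*) : Type _ :=
  PiLp 2 fun i => WithLp 2 (WithLp 2 (X i × Y i) × WithLp 2 (Y i × X i))

/-- The element of the Hilbert sum with given components. -/
def SumHilbert.mk (a : ∀ i, X i) (b c : ∀ i, Y i) (e : ∀ i, X i) : SumHilbert X Y :=
  WithLp.toLp 2 fun i => WithLp.toLp 2 (WithLp.toLp 2 (a i, b i), WithLp.toLp 2 (c i, e i))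

variable (S : ∀ i, Submodule ℝ (X i × Y i)) (R : ∀ i, Submodule ℝ (Y i × X i))

/-- The embedding `(p, q) ↦ (d⁻¹ p₁, p₂, q₁, d q₂)`. -/
def scaledEmb (d : ℝ) : ((∀ i, S i) × (∀ i, R i)) →ₗ[ℝ] SumHilbert X Y where
  toFun v := SumHilbert.mk (fun i => d⁻¹ • (v.1 i : X i × Y i).1)
    (fun i => (v.1 i : X i × Y i).2) (fun i => (v.2 i : Y i × X i).1)
    (fun i => d • (v.2 i : Y i × X i).2)
  map_add' v w := by
    simp only [Prod.fst_add, Prod.snd_add, Pi.add_apply, Submodule.coe_add, smul_add]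
    rfl
  map_smul' c v := by
    simp only [Prod.smul_fst, Prod.smul_snd, Pi.smul_apply, Submodule.coe_smul, smul_comm _ c]
    rfl

variable {S R}

theorem scaledEmb_injective {d : ℝ} (hd : d ≠ 0) : Function.Injective (scaledEmb S R d) := by
  intro v w h
  have h' : ∀ i, _ = _ := fun i => congrArg (fun x : SumHilbert X Y => x.ofLp i) h
  refine Prod.ext (funext fun i => Subtype.ext (Prod.ext ?_ ?_))
    (funext fun i => Subtype.ext (Prod.ext ?_ ?_))
  · exact smul_right_injective _ (inv_ne_zero hd) (congrArg (fun x => x.ofLp.1.ofLp.1) (h' i))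
  · exact congrArg (fun x => x.ofLp.1.ofLp.2) (h' i)
  · exact congrArg (fun x => x.ofLp.2.ofLp.1) (h' i)
  · exact smul_right_injective _ hd (congrArg (fun x => x.ofLp.2.ofLp.2) (h' i))

/-- Undoing the scaling is continuous, so the range is cut out by preimages of the closed sets `S i`
and `R i`. -/
theorem isClosed_range_scaledEmb {d : ℝ} (hd : d ≠ 0) (hS : ∀ i, IsClosed (S i : Set (X i × Y i)))
    (hR : ∀ i, IsClosed (R i : Set (Y i × X i))) : IsClosed (range (scaledEmb S R d)) := by
  have : range (scaledEmb S R d) = (⋂ i, {x : SumHilbert X Y |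
        (d • (x.ofLp i).ofLp.1.ofLp.1, (x.ofLp i).ofLp.1.ofLp.2) ∈ (S i : Set (X i × Y i))}) ∩
      ⋂ i, {x : SumHilbert X Y |
        ((x.ofLp i).ofLp.2.ofLp.1, d⁻¹ • (x.ofLp i).ofLp.2.ofLp.2) ∈ (R i : Set (Y i × X i))} := by
    ext x
    simp only [mem_inter_iff, mem_iInter]
    constructor
    · rintro ⟨v, rfl⟩
      refine ⟨fun i => ?_, fun i => ?_⟩
      · have h := (v.1 i).2
        rw [← Prod.mk.eta (p := (v.1 i : X i × Y i)), ← smul_inv_smul₀ hd (v.1 i : X i × Y i).1] at h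
        exact h
      · have h := (v.2 i).2
        rw [← Prod.mk.eta (p := (v.2 i : Y i × X i)), ← inv_smul_smul₀ hd (v.2 i : Y i × X i).2] at h
        exact h
    · rintro ⟨h1, h2⟩
      refine ⟨(fun i => ⟨_, h1 i⟩, fun i => ⟨_, h2 i⟩), ?_⟩
      simp [scaledEmb, SumHilbert.mk, smul_smul, hd]
      rfl
  rw [this]
  exact (isClosed_iInter fun i => (hS i).preimage (by fun_prop)).inter
    (isClosed_iInter fun i => (hR i).preimage (by fun_prop))

variable [Fintype ι]

theorem SumHilbert.inner_mk (a : ∀ i, X i) (b c : ∀ i, Y i) (e : ∀ i, X i)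
    (a' : ∀ i, X i) (b' c' : ∀ i, Y i) (e' : ∀ i, X i) :
    inner ℝ (SumHilbert.mk a b c e) (SumHilbert.mk a' b' c' e') =
      ∑ i, (inner ℝ (a i) (a' i) + inner ℝ (b i) (b' i) + inner ℝ (c i) (c' i)
        + inner ℝ (e i) (e' i)) := by
  simp only [SumHilbert.mk, PiLp.inner_apply, WithLp.prod_inner_apply]
  refine Finset.sum_congr rfl fun i _ => ?_
  ring

variable (S R)

theorem inner_mk_scaledEmb (d : ℝ) (a : ∀ i, X i) (b c : ∀ i, Y i) (e : ∀ i, X i)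
    (v : (∀ i, S i) × (∀ i, R i)) :
    inner ℝ (SumHilbert.mk a b c e) (scaledEmb S R d v) =
      ∑ i, (d⁻¹ * inner ℝ (a i) (v.1 i : X i × Y i).1 + inner ℝ (b i) (v.1 i : X i × Y i).2
        + inner ℝ (c i) (v.2 i : Y i × X i).1 + d * inner ℝ (e i) (v.2 i : Y i × X i).2) := by
  simp only [scaledEmb, LinearMap.coe_mk, AddHom.coe_mk, SumHilbert.inner_mk,
    real_inner_smul_right]

theorem inner_scaledEmb (d : ℝ) (v w : (∀ i, S i) × (∀ i, R i)) :
    inner ℝ (scaledEmb S R d v) (scaledEmb S R d w) =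
      ∑ i, ((d ^ 2)⁻¹ * inner ℝ (v.1 i : X i × Y i).1 (w.1 i : X i × Y i).1
        + inner ℝ (v.1 i : X i × Y i).2 (w.1 i : X i × Y i).2
        + inner ℝ (v.2 i : Y i × X i).1 (w.2 i : Y i × X i).1
        + d ^ 2 * inner ℝ (v.2 i : Y i × X i).2 (w.2 i : Y i × X i).2) := by
  simp only [scaledEmb, LinearMap.coe_mk, AddHom.coe_mk, SumHilbert.inner_mk,
    real_inner_smul_right, real_inner_smul_left]
  refine Finset.sum_congr rfl fun i _ => ?_
  ring

end Embedding

/-! ### The abstract Petrov--Galerkin scheme with optimal test functions -/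

section Abstract

variable {H V U : Type*} [NormedAddCommGroup H] [InnerProductSpace ℝ H]
  [AddCommGroup V] [Module ℝ V] [AddCommGroup U] [Module ℝ U]

/-- Riesz representation gives the operator pointwise; linearity follows since representers are
unique, `J` being injective. -/
theorem exists_trialToTest [CompleteSpace H] (J : V →ₗ[ℝ] H) (hJ : Function.Injective J)
    (hc : IsClosed (range J)) (b : U →ₗ[ℝ] V →ₗ[ℝ] ℝ) (C : U → ℝ)
    (hb : ∀ w v, |b w v| ≤ C w * ‖J v‖) :
    ∃ T : U →ₗ[ℝ] V, ∀ w v, inner ℝ (J (T w)) (J v) = b w v := by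
  choose T hT using fun w => exists_inner_eq_of_bound J hJ hc (b w) (C w) (hb w)
  have huniq : ∀ x y, (∀ v, inner ℝ (J x) (J v) = inner ℝ (J y) (J v)) → x = y := by
    intro x y h
    refine sub_eq_zero.1 (hJ ?_)
    rw [map_zero, ← inner_self_eq_zero (𝕜 := ℝ)]
    nth_rw 1 [map_sub]
    rw [inner_sub_left, h, sub_self]
  refine ⟨⟨⟨T, fun x y => huniq _ _ fun v => ?_⟩, fun c x => huniq _ _ fun v => ?_⟩, hT⟩
  · rw [map_add, inner_add_left, hT, hT, hT, map_add, LinearMap.add_apply]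
  · rw [RingHom.id_apply, map_smul, real_inner_smul_left, hT, hT, map_smul,
      LinearMap.smul_apply, smul_eq_mul]

/-- Well-posedness and quasi-optimality of the Petrov--Galerkin scheme with optimal test
functions, in a functional `N` that is controlled by the energy norm. -/
theorem abstract_dpg [CompleteSpace H] (J : V →ₗ[ℝ] H) (hJ : Function.Injective J)
    (hc : IsClosed (range J)) (b : U →ₗ[ℝ] V →ₗ[ℝ] ℝ) (C : U → ℝ)
    (hC : ∀ w, 0 ≤ C w) (hb : ∀ w v, |b w v| ≤ C w * ‖J v‖) (hinj : ∀ w, (∀ v, b w v = 0) → w = 0)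
    (N : U → ℝ) (c : ℝ) (hc0 : 0 ≤ c)
    (hN : ∀ w K, 0 ≤ K → (∀ v, |b w v| ≤ K * ‖J v‖) → N w ≤ c * K)
    (Uh : Submodule ℝ U) [FiniteDimensional ℝ Uh] (u : U) (l : V → ℝ) (hu : ∀ v, b u v = l v) :
    (∀ w, ∃! θ, ∀ v, inner ℝ (J θ) (J v) = b w v) ∧
    (∃! uh, uh ∈ Uh ∧ ∀ w ∈ Uh, ∀ θ, (∀ v, inner ℝ (J θ) (J v) = b w v) → b uh θ = l θ) ∧
    ∀ uh, (uh ∈ Uh ∧ ∀ w ∈ Uh, ∀ θ, (∀ v, inner ℝ (J θ) (J v) = b w v) → b uh θ = l θ) →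
      ∀ w ∈ Uh, N (u - uh) ≤ c * C (u - w) := by
  obtain ⟨T, hT⟩ := exists_trialToTest J hJ hc b C hb
  have huniq : ∀ w θ, (∀ v, inner ℝ (J θ) (J v) = b w v) → θ = T w := by
    intro w θ h
    refine sub_eq_zero.1 (hJ ?_)
    rw [map_zero, ← inner_self_eq_zero (𝕜 := ℝ)]
    nth_rw 1 [map_sub]
    rw [inner_sub_left, h, hT, sub_self]
  set A : U →ₗ[ℝ] H := J ∘ₗ T with hA
  have hAb : ∀ w x, inner ℝ (A w) (A x) = b w (T x) := fun w x => hT w (T x)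
  have hAinj : Function.Injective A := by
    refine (injective_iff_map_eq_zero A).2 fun w hw => hinj w fun v => ?_
    rw [← hT, ← LinearMap.comp_apply, ← hA, hw, inner_zero_left]
  -- As `b(u, ·)` equals `l`, the scheme says that `A (u - uh)` is orthogonal to `A(Uh)`.
  have hiff : ∀ uh, (∀ w ∈ Uh, ∀ θ, (∀ v, inner ℝ (J θ) (J v) = b w v) → b uh θ = l θ) ↔
      ∀ w ∈ Uh, inner ℝ (A (u - uh)) (A w) = 0 := by
    intro uh
    refine forall₂_congr fun w _ => ⟨fun h => ?_, fun h θ hθ => ?_⟩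
    · rw [hAb, map_sub, LinearMap.sub_apply, hu, h _ (hT w), sub_self]
    · rw [hAb, map_sub, LinearMap.sub_apply, hu] at h
      rw [huniq w θ hθ]
      linarith
  refine ⟨fun w => ⟨T w, hT w, huniq w⟩, ?_, fun uh ⟨huh, h⟩ w hw => ?_⟩
  · simp only [hiff]
    exact existsUnique_galerkin A hAinj Uh u
  · have h1 := norm_sub_le_of_galerkin A Uh huh ((hiff uh).1 h) hw
    have h2 : N (u - uh) ≤ c * ‖A (u - uh)‖ := by
      refine hN _ _ (norm_nonneg _) fun v => ?_
      rw [← hT]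
      exact abs_real_inner_le_norm _ _
    -- Testing with the representer itself gives `‖A x‖² = b(x, T x) ≤ C x * ‖A x‖` for `x = u - w`;
    -- divide by `‖A x‖` when it is nonzero.
    have h3 : ‖A (u - w)‖ ≤ C (u - w) := by
      have h4 := hb (u - w) (T (u - w))
      rw [← hAb, abs_of_nonneg real_inner_self_nonneg, real_inner_self_eq_norm_sq] at h4
      rcases (norm_nonneg (A (u - w))).eq_or_lt with h0 | h0
      · exact h0 ▸ hC _
      · exact le_of_mul_le_mul_right (by simpa [sq, hA] using h4) h0
    exact h2.trans (mul_le_mul_of_nonneg_left (h1.trans h3) hc0)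

end Abstract

/-! ### Auxiliary inequalities -/

/-- The infimum lies in the closure of `S` and the inequality is a closed condition on `r`; neither
attainment of the infimum nor a sign of `k` matters. -/
theorem le_add_mul_sInf_sq {S : Set ℝ} (hne : S.Nonempty) (h0 : ∀ r ∈ S, 0 ≤ r) {x a k : ℝ}
    (h : ∀ r ∈ S, x ≤ a + k * r ^ 2) : x ≤ a + k * sInf S ^ 2 := by
  have hcl : IsClosed {r : ℝ | x ≤ a + k * r ^ 2} := isClosed_le (by fun_prop) (by fun_prop)
  exact hcl.closure_subset_iff.2 h (csInf_mem_closure hne ⟨0, h0⟩)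

/-- The right side minus the left side is `‖a + b + c‖² + ‖b - c‖²`. This is the source of the
constant `√3`: the field `σ` is paired with both `τ` and `∇v`. -/
theorem norm_sub_sq_add_norm_sub_sq_le {H : Type*} [NormedAddCommGroup H] [InnerProductSpace ℝ H]
    (a b c : H) :
    ‖a - b‖ ^ 2 + ‖a - c‖ ^ 2 ≤ 3 * (‖a‖ ^ 2 + ‖b‖ ^ 2 + ‖c‖ ^ 2) := by
  have h1 := norm_add_sq_real (a + b) c
  rw [norm_add_sq_real a b, inner_add_left] at h1
  have h2 := norm_sub_sq_real b c
  rw [norm_sub_sq_real, norm_sub_sq_real]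
  nlinarith [sq_nonneg ‖a + b + c‖, sq_nonneg ‖b - c‖]

theorem norm_sub_sq_le_three {H : Type*} [NormedAddCommGroup H] [InnerProductSpace ℝ H]
    (a b : H) : ‖a - b‖ ^ 2 ≤ 3 * (‖a‖ ^ 2 + ‖b‖ ^ 2) := by
  have h1 := norm_add_sq_real a b
  rw [norm_sub_sq_real]
  nlinarith [sq_nonneg ‖a + b‖, sq_nonneg ‖a‖, sq_nonneg ‖b‖]

/-- The stability estimate for the adjoint problem `τ + ∇v = σ`, `div τ = d⁻² u`. -/
theorem adjoint_stability {A H : Type*} [NormedAddCommGroup A] [InnerProductSpace ℝ A]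
    [NormedAddCommGroup H] [InnerProductSpace ℝ H] {d : ℝ} (hd : 0 < d) (u v : A) (σ g : H)
    (hv : ‖v‖ ≤ d * ‖g‖) (h : inner ℝ g g = inner ℝ σ g + inner ℝ ((d ^ 2)⁻¹ • u) v) :
    (d ^ 2)⁻¹ * ‖v‖ ^ 2 + ‖g‖ ^ 2 + ‖σ - g‖ ^ 2 + d ^ 2 * ‖(d ^ 2)⁻¹ • u‖ ^ 2
      ≤ 6 * ((d ^ 2)⁻¹ * ‖u‖ ^ 2 + ‖σ‖ ^ 2) := by
  -- In the scaled quantities `a = ‖u‖/d` and `y = ‖v‖/d` the parameter `d` disappears, and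
  -- Poincaré–Friedrichs reads `y ≤ ‖g‖`.
  obtain ⟨a, ha⟩ : ∃ a, a = d⁻¹ * ‖u‖ := ⟨_, rfl⟩
  obtain ⟨y, hy⟩ : ∃ y, y = d⁻¹ * ‖v‖ := ⟨_, rfl⟩
  have ha0 : 0 ≤ a := by rw [ha]; positivity
  have hy1 : y ≤ ‖g‖ := by
    rw [hy, inv_mul_le_iff₀ hd]; exact hv
  have hy0 : 0 ≤ y := by rw [hy]; positivity
  have e1 : (d ^ 2)⁻¹ * ‖v‖ ^ 2 = y ^ 2 := by rw [hy]; ring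
  have e2 : (d ^ 2)⁻¹ * ‖u‖ ^ 2 = a ^ 2 := by rw [ha]; ring
  have e3 : d ^ 2 * ‖(d ^ 2)⁻¹ • u‖ ^ 2 = a ^ 2 := by
    rw [norm_smul, ha, Real.norm_of_nonneg (by positivity)]
    field_simp
  have h1 : inner ℝ ((d ^ 2)⁻¹ • u) v ≤ a * y := by
    rw [real_inner_smul_left]
    have := mul_le_mul_of_nonneg_left (real_inner_le_norm u v)
      (inv_nonneg.2 (sq_nonneg d))
    calc _ ≤ _ := this
      _ = a * y := by rw [ha, hy]; ring
  have h2 := real_inner_le_norm σ g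
  have h3 := norm_sub_sq_real σ g
  rw [real_inner_self_eq_norm_sq] at h
  rw [e1, e2, e3, h3]
  have hg0 := norm_nonneg g
  have hs0 := norm_nonneg σ
  have h4 : a * y ≤ a * ‖g‖ := mul_le_mul_of_nonneg_left hy1 ha0
  -- The energy identity gives `‖g‖² ≤ (‖σ‖ + a) ‖g‖`.
  have h5 : ‖g‖ ≤ ‖σ‖ + a := by
    by_contra hcon
    push Not at hcon
    nlinarith
  have h6 : y ^ 2 ≤ ‖g‖ ^ 2 := pow_le_pow_left₀ hy0 hy1 2
  have h7 : ‖g‖ ^ 2 ≤ (‖σ‖ + a) ^ 2 := pow_le_pow_left₀ hg0 h5 2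
  have h8 : a * ‖g‖ ≤ a * (‖σ‖ + a) := mul_le_mul_of_nonneg_left h5 ha0
  -- Eliminating `⟪σ, g⟫` by `h` bounds the left side by `y² + ‖σ‖² + 2ay + a²`. With `y ≤ ‖σ‖ + a`
  -- this is at most `2‖σ‖² + 4a‖σ‖ + 4a²`, and `2a‖σ‖ ≤ a² + ‖σ‖²` leads to the factor 6.
  nlinarith [sq_nonneg (‖σ‖ - a), sq_nonneg ‖σ‖, sq_nonneg a]

/-! ### The bilinear form -/

theorem trGradΩ_apply (hΩ : IsOpen Ω) (M : Mesh Ω) (v : H1 Ω) (τ : HdivT M) :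
    trGradΩ hΩ M v τ = ∑ i, (inner ℝ (restrL2 (M.subset i) (H1.fn v)) (Hdiv.div (τ i))
      + inner ℝ (restrL2 (M.subset i) (H1.grad v)) (Hdiv.fn (τ i))) :=
  trGrad_apply M (toH1T hΩ M v) τ

theorem trDivΩ_apply (hΩ : IsOpen Ω) (M : Mesh Ω) (τ : Hdiv Ω) (v : H1T M) :
    trDivΩ hΩ M τ v = ∑ i, (inner ℝ (restrL2 (M.subset i) (Hdiv.fn τ)) (H1.grad (v i))
      + inner ℝ (restrL2 (M.subset i) (Hdiv.div τ)) (H1.fn (v i))) :=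
  trDiv_apply M (toHdivT hΩ M τ) v

theorem trGradΩ_toHdivT (hΩ : IsOpen Ω) (M : Mesh Ω) (v : H1 Ω) (τ : Hdiv Ω) :
    trGradΩ hΩ M v (toHdivT hΩ M τ) =
      inner ℝ (H1.fn v) (Hdiv.div τ) + inner ℝ (H1.grad v) (Hdiv.fn τ) := by
  rw [trGradΩ_apply]
  exact Finset.sum_add_distrib.trans
    (congrArg₂ (· + ·) (sum_inner_restrL2 M _ _) (sum_inner_restrL2 M _ _))

theorem trDivΩ_toH1T (hΩ : IsOpen Ω) (M : Mesh Ω) (τ : Hdiv Ω) (v : H1 Ω) :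
    trDivΩ hΩ M τ (toH1T hΩ M v) =
      inner ℝ (Hdiv.fn τ) (H1.grad v) + inner ℝ (Hdiv.div τ) (H1.fn v) := by
  rw [trDivΩ_apply]
  exact Finset.sum_add_distrib.trans
    (congrArg₂ (· + ·) (sum_inner_restrL2 M _ _) (sum_inner_restrL2 M _ _))

theorem HOtr.exists_lift {hΩ : IsOpen Ω} {M : Mesh Ω} (vhat : HOtr hΩ M) :
    ∃ v ∈ H10 Ω, trGradΩ hΩ M v = HOtr.toDual vhat :=
  Submodule.mem_map.1 vhat.2

theorem Hdivtr.exists_lift {hΩ : IsOpen Ω} {M : Mesh Ω} (τhat : Hdivtr hΩ M) :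
    ∃ τ, trDivΩ hΩ M τ = Hdivtr.toDual τhat :=
  LinearMap.mem_range.1 τhat.2

/-- On a conforming field the element contributions add up to an integral over `Ω`, which vanishes
because the trace has a lift in `H¹₀(Ω)`. -/
theorem HOtr.toDual_toHdivT {hΩ : IsOpen Ω} {M : Mesh Ω} (vhat : HOtr hΩ M) (τ : Hdiv Ω) :
    HOtr.toDual vhat (toHdivT hΩ M τ) = 0 := by
  obtain ⟨v, hv, h⟩ := vhat.exists_lift
  rw [← h, trGradΩ_toHdivT]
  exact inner_div_add_inner_grad_eq_zero hv τ

theorem Hdivtr.toDual_toH1T {hΩ : IsOpen Ω} {M : Mesh Ω} (τhat : Hdivtr hΩ M) {v : H1 Ω}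
    (hv : v ∈ H10 Ω) : Hdivtr.toDual τhat (toH1T hΩ M v) = 0 := by
  obtain ⟨τ, h⟩ := τhat.exists_lift
  rw [← h, trDivΩ_toH1T, add_comm]
  exact (congrArg₂ (· + ·) (real_inner_comm _ _) (real_inner_comm _ _)).trans
    (inner_div_add_inner_grad_eq_zero hv τ)

/-- The bilinear form of the ultraweak formulation as a bilinear map. -/
def bformₗ (hΩ : IsOpen Ω) (M : Mesh Ω) (γ : ℝ) : USp hΩ M →ₗ[ℝ] VSp M →ₗ[ℝ] ℝ :=
  LinearMap.mk₂ ℝ (bform hΩ M γ)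
    (by
      intro u w v
      simp only [bform, Prod.fst_add, Prod.snd_add, map_add, inner_add_left,
        LinearMap.add_apply, Finset.sum_add_distrib]
      ring)
    (by
      intro c u v
      simp only [bform, Prod.smul_fst, Prod.smul_snd, map_smul, real_inner_smul_left,
        LinearMap.smul_apply, smul_eq_mul, ← mul_add, ← Finset.mul_sum]
      ring)
    (by
      intro u v w
      simp only [bform, Prod.fst_add, Prod.snd_add, Pi.add_apply, map_add, inner_add_right,
        smul_add, Finset.sum_add_distrib]
      ring)
    (by
      intro c u v
      simp only [bform, Prod.smul_fst, Prod.smul_snd, Pi.smul_apply, map_smul,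
        smul_comm γ c, ← smul_add, real_inner_smul_right, smul_eq_mul, ← mul_add,
        ← Finset.mul_sum]
      ring)

theorem bformₗ_apply (hΩ : IsOpen Ω) (M : Mesh Ω) (γ : ℝ) (u : USp hΩ M) (v : VSp M) :
    bformₗ hΩ M γ u v = bform hΩ M γ u v := rfl

/-- The embedding of the test space into a Hilbert space that realizes the scaled inner product. -/
def testEmb (M : Mesh Ω) (d : ℝ) :
    VSp M →ₗ[ℝ] SumHilbert (fun i => L2 (M.T i)) (fun i => L2v (M.T i)) :=
  scaledEmb (fun i => H1 (M.T i)) (fun i => Hdiv (M.T i)) d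

theorem inner_testEmb (M : Mesh Ω) (d : ℝ) (v w : VSp M) :
    inner ℝ (testEmb M d v) (testEmb M d w) = ipV M d v w :=
  inner_scaledEmb _ _ d v w

theorem testEmb_injective (M : Mesh Ω) {d : ℝ} (hd : d ≠ 0) :
    Function.Injective (testEmb M d) :=
  scaledEmb_injective hd

theorem isClosed_range_testEmb (M : Mesh Ω) {d : ℝ} (hd : d ≠ 0) :
    IsClosed (range (testEmb M d)) :=
  isClosed_range_scaledEmb hd (fun _ => isClosed_H1 _) (fun _ => isClosed_Hdiv _)

/-! ### Boundedness of the bilinear form -/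

/-- Collects the terms by the test components `v`, `∇v`, `τ`, `div τ`, with the powers of `d` used
by `scaledEmb`. -/
theorem bform_integrand_eq {X Y : Type*} [NormedAddCommGroup X] [InnerProductSpace ℝ X]
    [NormedAddCommGroup Y] [InnerProductSpace ℝ Y] {d : ℝ} (hd : d ≠ 0)
    (u p q v t : X) (σ g s τ w : Y) :
    inner ℝ u (t + (0 : ℝ) • v) + inner ℝ σ (τ + w) - (inner ℝ p t + inner ℝ g τ)
      - (inner ℝ s w + inner ℝ q v) =
    d⁻¹ * inner ℝ (-(d • q)) v + inner ℝ (σ - s) w + inner ℝ (σ - g) τ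
      + d * inner ℝ (d⁻¹ • (u - p)) t := by
  simp only [zero_smul, add_zero, inner_add_right, inner_neg_left, inner_sub_left,
    real_inner_smul_left]
  field_simp
  ring

/-- The Hilbert sum element with components the restrictions of functions on `Ω`. -/
def globalElt (M : Mesh Ω) (a : L2 Ω) (b c : L2v Ω) (e : L2 Ω) :
    SumHilbert (fun i => L2 (M.T i)) (fun i => L2v (M.T i)) :=
  SumHilbert.mk (fun i => restrL2 (M.subset i) a) (fun i => restrL2 (M.subset i) b)
    (fun i => restrL2 (M.subset i) c) (fun i => restrL2 (M.subset i) e)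

theorem norm_globalElt_sq (M : Mesh Ω) (a : L2 Ω) (b c : L2v Ω) (e : L2 Ω) :
    ‖globalElt M a b c e‖ ^ 2 = ‖a‖ ^ 2 + ‖b‖ ^ 2 + ‖c‖ ^ 2 + ‖e‖ ^ 2 := by
  have ha : _ = ‖a‖ ^ 2 := (sum_inner_restrL2 M a a).trans (real_inner_self_eq_norm_sq a)
  have hb : _ = ‖b‖ ^ 2 := (sum_inner_restrL2 M b b).trans (real_inner_self_eq_norm_sq b)
  have hc : _ = ‖c‖ ^ 2 := (sum_inner_restrL2 M c c).trans (real_inner_self_eq_norm_sq c)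
  have he : _ = ‖e‖ ^ 2 := (sum_inner_restrL2 M e e).trans (real_inner_self_eq_norm_sq e)
  rw [← ha, ← hb, ← hc, ← he, ← Finset.sum_add_distrib, ← Finset.sum_add_distrib,
    ← Finset.sum_add_distrib, ← real_inner_self_eq_norm_sq]
  exact SumHilbert.inner_mk _ _ _ _ _ _ _ _

theorem bform_eq_sum_of_lift (hΩ : IsOpen Ω) (M : Mesh Ω) (u : USp hΩ M)
    {p : H1 Ω} (hp : trGradΩ hΩ M p = HOtr.toDual u.2.2.1)
    {s : Hdiv Ω} (hs : trDivΩ hΩ M s = Hdivtr.toDual u.2.2.2) (v : VSp M) :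
    bform hΩ M 0 u v = ∑ i,
      (inner ℝ (restrL2 (M.subset i) u.1) (Hdiv.div (v.2 i) + (0 : ℝ) • H1.fn (v.1 i))
        + inner ℝ (restrL2 (M.subset i) u.2.1) (Hdiv.fn (v.2 i) + H1.grad (v.1 i))
        - (inner ℝ (restrL2 (M.subset i) (H1.fn p)) (Hdiv.div (v.2 i))
          + inner ℝ (restrL2 (M.subset i) (H1.grad p)) (Hdiv.fn (v.2 i)))
        - (inner ℝ (restrL2 (M.subset i) (Hdiv.fn s)) (H1.grad (v.1 i))
          + inner ℝ (restrL2 (M.subset i) (Hdiv.div s)) (H1.fn (v.1 i)))) := by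
  have e1 := (LinearMap.congr_fun hp v.2).symm.trans (trGradΩ_apply hΩ M p v.2)
  have e2 := (LinearMap.congr_fun hs v.1).symm.trans (trDivΩ_apply hΩ M s v.1)
  rw [Finset.sum_sub_distrib, Finset.sum_sub_distrib]
  exact congrArg₂ (· - ·) (congrArg₂ (· - ·) rfl e1) e2

/-- The representing element need not lie in the range of `testEmb`; it is only used for
Cauchy–Schwarz, with a norm computed from global functions. -/
theorem bform_eq_inner (hΩ : IsOpen Ω) (M : Mesh Ω) {d : ℝ} (hd : d ≠ 0) (u : USp hΩ M)
    {p : H1 Ω} (hp : trGradΩ hΩ M p = HOtr.toDual u.2.2.1)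
    {s : Hdiv Ω} (hs : trDivΩ hΩ M s = Hdivtr.toDual u.2.2.2) (v : VSp M) :
    bform hΩ M 0 u v = inner ℝ (globalElt M (-(d • Hdiv.div s)) (u.2.1 - Hdiv.fn s)
      (u.2.1 - H1.grad p) (d⁻¹ • (u.1 - H1.fn p))) (testEmb M d v) := by
  refine (bform_eq_sum_of_lift hΩ M u hp hs v).trans
    (Eq.trans ?_ (inner_mk_scaledEmb _ _ d _ _ _ _ v).symm)
  refine Finset.sum_congr rfl fun i _ => ?_
  simp only [map_neg, map_sub, map_smul]
  exact bform_integrand_eq hd _ _ _ _ _ _ _ _ _ _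

/-- The estimate behind the boundedness of the bilinear form with constant `√3`. -/
theorem lift_norm_le {A H : Type*} [NormedAddCommGroup A] [InnerProductSpace ℝ A]
    [NormedAddCommGroup H] [InnerProductSpace ℝ H] (d : ℝ) (u p q : A) (σ g s : H) :
    ‖-(d • q)‖ ^ 2 + ‖σ - s‖ ^ 2 + ‖σ - g‖ ^ 2 + ‖d⁻¹ • (u - p)‖ ^ 2 ≤
      3 * ((d ^ 2)⁻¹ * ‖u‖ ^ 2 + ‖σ‖ ^ 2 + ((d ^ 2)⁻¹ * ‖p‖ ^ 2 + ‖g‖ ^ 2)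
        + (‖s‖ ^ 2 + d ^ 2 * ‖q‖ ^ 2)) := by
  have h1 := norm_sub_sq_add_norm_sub_sq_le σ s g
  have h2 := mul_le_mul_of_nonneg_left (norm_sub_sq_le_three u p) (inv_nonneg.2 (sq_nonneg d))
  have h3 : 0 ≤ d ^ 2 * ‖q‖ ^ 2 := by positivity
  rw [norm_neg, norm_smul, norm_smul, mul_pow, mul_pow, Real.norm_eq_abs, Real.norm_eq_abs,
    sq_abs, sq_abs, inv_pow]
  linarith

theorem normH1_sq (d : ℝ) (v : H1 D) :
    normH1 d v ^ 2 = (d ^ 2)⁻¹ * ‖H1.fn v‖ ^ 2 + ‖H1.grad v‖ ^ 2 :=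
  Real.sq_sqrt (by positivity)

theorem normHdiv_sq (d : ℝ) (τ : Hdiv D) :
    normHdiv d τ ^ 2 = ‖Hdiv.fn τ‖ ^ 2 + d ^ 2 * ‖Hdiv.div τ‖ ^ 2 :=
  Real.sq_sqrt (by positivity)

theorem normU_nonneg (hΩ : IsOpen Ω) (M : Mesh Ω) (d : ℝ) (u : USp hΩ M) :
    0 ≤ normU hΩ M d u := Real.sqrt_nonneg _

theorem real_inner_sq_le {H : Type*} [NormedAddCommGroup H] [InnerProductSpace ℝ H] (x y : H) :
    inner ℝ x y ^ 2 ≤ ‖x‖ ^ 2 * ‖y‖ ^ 2 := by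
  rw [← mul_pow]
  exact sq_le_sq' (neg_le_of_abs_le (abs_real_inner_le_norm x y)) (real_inner_le_norm x y)

theorem bform_sq_le_of_lift (hΩ : IsOpen Ω) (M : Mesh Ω) {d : ℝ} (hd : d ≠ 0) (u : USp hΩ M)
    {p : H1 Ω} (hp : trGradΩ hΩ M p = HOtr.toDual u.2.2.1)
    {s : Hdiv Ω} (hs : trDivΩ hΩ M s = Hdivtr.toDual u.2.2.2) (v : VSp M) :
    bform hΩ M 0 u v ^ 2 ≤ 3 * ((d ^ 2)⁻¹ * ‖u.1‖ ^ 2 + ‖u.2.1‖ ^ 2 + normH1 d p ^ 2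
      + normHdiv d s ^ 2) * ‖testEmb M d v‖ ^ 2 := by
  have h1 : ‖globalElt M (-(d • Hdiv.div s)) (u.2.1 - Hdiv.fn s) (u.2.1 - H1.grad p)
      (d⁻¹ • (u.1 - H1.fn p))‖ ^ 2 ≤ 3 * ((d ^ 2)⁻¹ * ‖u.1‖ ^ 2 + ‖u.2.1‖ ^ 2
        + normH1 d p ^ 2 + normHdiv d s ^ 2) :=
    ((norm_globalElt_sq M _ _ _ _).trans_le (lift_norm_le d _ _ _ _ _ _)).trans_eq
      (congrArg₂ (fun x y => 3 * ((d ^ 2)⁻¹ * ‖u.1‖ ^ 2 + ‖u.2.1‖ ^ 2 + x + y))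
        (normH1_sq d p).symm (normHdiv_sq d s).symm)
  exact (congrArg (· ^ 2) (bform_eq_inner hΩ M hd u hp hs v)).trans_le
    ((real_inner_sq_le _ _).trans (mul_le_mul_of_nonneg_right h1 (sq_nonneg _)))

/-- The two lifts are independent, so the infima can be taken one after the other. -/
theorem le_of_forall_lift {S S' : Set ℝ} (hS : S.Nonempty) (hS0 : ∀ r ∈ S, 0 ≤ r)
    (hS' : S'.Nonempty) (hS0' : ∀ r ∈ S', 0 ≤ r) {x a c k : ℝ}
    (h : ∀ r ∈ S, ∀ r' ∈ S', x ≤ c * (a + r ^ 2 + r' ^ 2) * k) :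
    x ≤ c * (a + sInf S ^ 2 + sInf S' ^ 2) * k := by
  have h1 : ∀ r ∈ S, x ≤ (c * a * k + c * k * r ^ 2) + c * k * sInf S' ^ 2 := fun r hr =>
    le_add_mul_sInf_sq hS' hS0' fun r' hr' => (h r hr r' hr').trans_eq (by ring)
  have h2 : x ≤ (c * a * k + c * k * sInf S' ^ 2) + c * k * sInf S ^ 2 :=
    le_add_mul_sInf_sq hS hS0 fun r hr => (h1 r hr).trans_eq (by ring)
  exact h2.trans_eq (by ring)

theorem normU_sq (hΩ : IsOpen Ω) (M : Mesh Ω) (d : ℝ) (u : USp hΩ M) :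
    normU hΩ M d u ^ 2 = (d ^ 2)⁻¹ * ‖u.1‖ ^ 2 + ‖u.2.1‖ ^ 2 + normHalf hΩ M d u.2.2.1 ^ 2
      + normNegHalf hΩ M d u.2.2.2 ^ 2 :=
  Real.sq_sqrt (by positivity)

theorem bform_sq_le (hΩ : IsOpen Ω) (M : Mesh Ω) {d : ℝ} (hd : d ≠ 0) (u : USp hΩ M)
    (v : VSp M) :
    bform hΩ M 0 u v ^ 2 ≤ 3 * normU hΩ M d u ^ 2 * ‖testEmb M d v‖ ^ 2 := by
  obtain ⟨p, -, hp⟩ := u.2.2.1.exists_lift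
  obtain ⟨s, hs⟩ := u.2.2.2.exists_lift
  refine (le_of_forall_lift (S := {r | ∃ v : H1 Ω,
      trGradΩ hΩ M v = HOtr.toDual u.2.2.1 ∧ r = normH1 d v}) (S' := {r | ∃ τ : Hdiv Ω,
      trDivΩ hΩ M τ = Hdivtr.toDual u.2.2.2 ∧ r = normHdiv d τ})
    ⟨_, p, hp, rfl⟩ ?_ ⟨_, s, hs, rfl⟩ ?_ ?_).trans_eq
    (congrArg (3 * · * ‖testEmb M d v‖ ^ 2) (normU_sq hΩ M d u).symm)
  · rintro _ ⟨p, -, rfl⟩; exact Real.sqrt_nonneg _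
  · rintro _ ⟨s, -, rfl⟩; exact Real.sqrt_nonneg _
  · rintro _ ⟨p, hp, rfl⟩ _ ⟨s, hs, rfl⟩
    exact bform_sq_le_of_lift hΩ M hd u hp hs v

theorem abs_bform_le (hΩ : IsOpen Ω) (M : Mesh Ω) {d : ℝ} (hd : d ≠ 0) (u : USp hΩ M)
    (v : VSp M) :
    |bform hΩ M 0 u v| ≤ Real.sqrt 3 * normU hΩ M d u * ‖testEmb M d v‖ := by
  refine abs_le_of_sq_le_sq ?_ (mul_nonneg (mul_nonneg (Real.sqrt_nonneg _)
    (normU_nonneg hΩ M d u)) (norm_nonneg _))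
  rw [mul_pow, mul_pow, Real.sq_sqrt (by norm_num)]
  exact bform_sq_le hΩ M hd u v

/-! ### Stability of the bilinear form -/

/-- The scaled norm of the field variables `(u, σ)`. -/
def normField (d : ℝ) (u : L2 Ω) (σ : L2v Ω) : ℝ :=
  Real.sqrt ((d ^ 2)⁻¹ * ‖u‖ ^ 2 + ‖σ‖ ^ 2)

theorem normField_sq (d : ℝ) (u : L2 Ω) (σ : L2v Ω) :
    normField d u σ ^ 2 = (d ^ 2)⁻¹ * ‖u‖ ^ 2 + ‖σ‖ ^ 2 :=
  Real.sq_sqrt (by positivity)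

theorem bform_conforming (hΩ : IsOpen Ω) (M : Mesh Ω) (u : USp hΩ M) {v : H1 Ω}
    (hv : v ∈ H10 Ω) (τ : Hdiv Ω) :
    bform hΩ M 0 u (toH1T hΩ M v, toHdivT hΩ M τ) =
      inner ℝ u.1 (Hdiv.div τ) + (inner ℝ u.2.1 (Hdiv.fn τ) + inner ℝ u.2.1 (H1.grad v)) := by
  have e1 := HOtr.toDual_toHdivT u.2.2.1 τ
  have e2 := Hdivtr.toDual_toH1T u.2.2.2 hv
  refine (congrArg₂ (· - ·) (congrArg₂ (· - ·) ?_ e1) e2).trans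
    ((sub_zero _).trans (sub_zero _))
  refine Finset.sum_add_distrib.trans (congrArg₂ (· + ·) ?_ ?_)
  · simp only [zero_smul, add_zero]
    exact sum_inner_restrL2 M _ _
  · simp only [inner_add_right]
    exact Finset.sum_add_distrib.trans
      (congrArg₂ (· + ·) (sum_inner_restrL2 M _ _) (sum_inner_restrL2 M _ _))

theorem sum_scaled_eq {ι : Type*} [Fintype ι] {a b c e : ι → ℝ} {k l A B C E : ℝ}
    (ha : ∑ i, a i = A) (hb : ∑ i, b i = B) (hc : ∑ i, c i = C) (he : ∑ i, e i = E) :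
    ∑ i, (k * a i + b i + c i + l * e i) = k * A + B + C + l * E := by
  simp only [Finset.sum_add_distrib, ← Finset.mul_sum, ha, hb, hc, he]

theorem norm_testEmb_conforming_sq (hΩ : IsOpen Ω) (M : Mesh Ω) (d : ℝ) (v : H1 Ω)
    (τ : Hdiv Ω) :
    ‖testEmb M d (toH1T hΩ M v, toHdivT hΩ M τ)‖ ^ 2 =
      (d ^ 2)⁻¹ * ‖H1.fn v‖ ^ 2 + ‖H1.grad v‖ ^ 2 + ‖Hdiv.fn τ‖ ^ 2
        + d ^ 2 * ‖Hdiv.div τ‖ ^ 2 := by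
  refine (real_inner_self_eq_norm_sq _).symm.trans ((inner_testEmb M d _ _).trans ?_)
  exact sum_scaled_eq ((sum_inner_restrL2 M _ _).trans (real_inner_self_eq_norm_sq _))
    ((sum_inner_restrL2 M _ _).trans (real_inner_self_eq_norm_sq _))
    ((sum_inner_restrL2 M _ _).trans (real_inner_self_eq_norm_sq _))
    ((sum_inner_restrL2 M _ _).trans (real_inner_self_eq_norm_sq _))

/-- Solvability of the adjoint problem `τ + ∇v = σ`, `div τ = d⁻² u`. -/
theorem exists_adjoint {d : ℝ} (hPF : PoincareFriedrichs Ω d) (u : L2 Ω) (σ : L2v Ω) :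
    ∃ v ∈ H10 Ω, ∃ τ : Hdiv Ω, Hdiv.fn τ = σ - H1.grad v ∧ Hdiv.div τ = (d ^ 2)⁻¹ • u ∧
      inner ℝ (H1.grad v) (H1.grad v)
        = inner ℝ σ (H1.grad v) + inner ℝ ((d ^ 2)⁻¹ • u) (H1.fn v) := by
  obtain ⟨v, hv, h⟩ := exists_poisson hPF σ ((d ^ 2)⁻¹ • u)
  have hdiv : HasWeakDiv Ω (σ - H1.grad v) ((d ^ 2)⁻¹ • u) := by
    refine hasWeakDiv_of_forall_H10 fun w hw => ?_
    rw [inner_sub_left, h w hw]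
    ring
  exact ⟨v, hv, ⟨(_, _), hdiv⟩, rfl, rfl, h v hv⟩

theorem adjoint_pairing {A H : Type*} [NormedAddCommGroup A] [InnerProductSpace ℝ A]
    [NormedAddCommGroup H] [InnerProductSpace ℝ H] {c : ℝ} {u q : A} {σ g τ : H}
    (hτ : τ = σ - g) (hq : q = c • u) :
    inner ℝ u q + (inner ℝ σ τ + inner ℝ σ g) = c * ‖u‖ ^ 2 + ‖σ‖ ^ 2 := by
  rw [← inner_add_right, hτ, hq, sub_add_cancel, real_inner_smul_right,
    real_inner_self_eq_norm_sq, real_inner_self_eq_norm_sq]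

/-- The conforming solution of the adjoint problem removes the traces from `b`, so control of the
fields needs no control of `û` and `σ̂`. -/
theorem exists_test_of_field (hΩ : IsOpen Ω) (M : Mesh Ω) {d : ℝ} (hd : 0 < d)
    (hPF : PoincareFriedrichs Ω d) (u : USp hΩ M) :
    ∃ v : VSp M, bform hΩ M 0 u v = normField d u.1 u.2.1 ^ 2 ∧
      ‖testEmb M d v‖ ≤ Real.sqrt 6 * normField d u.1 u.2.1 := by
  obtain ⟨v, hv, τ, h1, h2, h3⟩ := exists_adjoint hPF u.1 u.2.1
  refine ⟨(toH1T hΩ M v, toHdivT hΩ M τ), ?_, ?_⟩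
  · exact (bform_conforming hΩ M u hv τ).trans
      ((adjoint_pairing h1 h2).trans (normField_sq d u.1 u.2.1).symm)
  · have h4 : ‖testEmb M d (toH1T hΩ M v, toHdivT hΩ M τ)‖ ^ 2
        ≤ 6 * normField d u.1 u.2.1 ^ 2 :=
      (norm_testEmb_conforming_sq hΩ M d v τ).trans_le
        ((congrArg₂ (fun x y => (d ^ 2)⁻¹ * ‖H1.fn v‖ ^ 2 + ‖H1.grad v‖ ^ 2 + ‖x‖ ^ 2
          + d ^ 2 * ‖y‖ ^ 2) h1 h2).trans_le ((adjoint_stability hd _ _ _ _ (hPF v hv) h3).trans_eq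
            (congrArg (6 * ·) (normField_sq d u.1 u.2.1).symm)))
    refine (Real.le_sqrt (norm_nonneg _) (by positivity)).2 h4 |>.trans_eq ?_
    rw [Real.sqrt_mul (by norm_num), Real.sqrt_sq (x := normField d u.1 u.2.1) (Real.sqrt_nonneg _)]

theorem normField_le (hΩ : IsOpen Ω) (M : Mesh Ω) {d : ℝ} (hd : 0 < d)
    (hPF : PoincareFriedrichs Ω d) (u : USp hΩ M) (K : ℝ) (hK0 : 0 ≤ K)
    (hK : ∀ v, |bform hΩ M 0 u v| ≤ K * ‖testEmb M d v‖) :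
    normField d u.1 u.2.1 ≤ Real.sqrt 6 * K := by
  obtain ⟨v, h1, h2⟩ := exists_test_of_field hΩ M hd hPF u
  have h3 := (le_abs_self _).trans (hK v)
  rw [h1] at h3
  have hN : 0 ≤ normField d u.1 u.2.1 := Real.sqrt_nonneg _
  generalize normField d u.1 u.2.1 = N at *
  -- The chain `N² = b(u, v) ≤ K ‖v‖_V ≤ K √6 N` is divided by `N`, which has to be positive.
  rcases hN.eq_or_lt with h0 | h0
  · rw [← h0]; positivity
  · have h4 := mul_le_mul_of_nonneg_left h2 hK0
    refine le_of_mul_le_mul_right ?_ h0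
    linarith [sq N]

/-- The adjoint test pair forces the fields to vanish. Test pairs with one zero component then
separate the two traces, which are zero once they vanish as functionals. -/
theorem eq_zero_of_bform_eq_zero (hΩ : IsOpen Ω) (M : Mesh Ω) {d : ℝ} (hd : 0 < d)
    (hPF : PoincareFriedrichs Ω d) (u : USp hΩ M) (h : ∀ v, bform hΩ M 0 u v = 0) : u = 0 := by
  obtain ⟨v, hv, -⟩ := exists_test_of_field hΩ M hd hPF u
  rw [h, normField_sq] at hv
  have hd2 : 0 < (d ^ 2)⁻¹ := by positivity
  have hu2 : 0 ≤ (d ^ 2)⁻¹ * ‖u.1‖ ^ 2 := by positivity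
  have hs2 : 0 ≤ ‖u.2.1‖ ^ 2 := by positivity
  have hs : u.2.1 = 0 := norm_eq_zero.1 (pow_eq_zero_iff two_ne_zero |>.1 (by linarith))
  have hu : u.1 = 0 := by
    have h0 : (d ^ 2)⁻¹ * ‖u.1‖ ^ 2 = 0 := by linarith
    exact norm_eq_zero.1 (pow_eq_zero_iff two_ne_zero |>.1
      ((mul_eq_zero.1 h0).resolve_left hd2.ne'))
  have hb : ∀ v : VSp M, HOtr.toDual u.2.2.1 v.2 + Hdivtr.toDual u.2.2.2 v.1 = 0 := by
    intro v
    have := h v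
    simp only [bform, hu, hs, map_zero, inner_zero_left, add_zero, Finset.sum_const_zero] at this
    linarith
  refine Prod.ext hu (Prod.ext hs (Prod.ext ?_ ?_))
  · refine Subtype.ext (LinearMap.ext fun τ => ?_)
    have := hb (0, τ)
    rwa [map_zero, add_zero] at this
  · refine Subtype.ext (LinearMap.ext fun v => ?_)
    have := hb (v, 0)
    rwa [map_zero, zero_add] at this

/-! ### The ultraweak formulation -/

theorem exists_div_grad_eq {d : ℝ} (hPF : PoincareFriedrichs Ω d) (f : L2 Ω) :
    ∃ p ∈ H10 Ω, ∃ s : Hdiv Ω, Hdiv.fn s = H1.grad p ∧ Hdiv.div s = -f := by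
  obtain ⟨p, hp, h⟩ := exists_poisson hPF 0 f
  have hdiv : HasWeakDiv Ω (H1.grad p) (-f) := by
    refine hasWeakDiv_of_forall_H10 fun w hw => (h w hw).trans ?_
    rw [inner_zero_left, zero_add, inner_neg_left, neg_neg]
  exact ⟨p, hp, ⟨(_, _), hdiv⟩, rfl, rfl⟩

theorem ultraweak_integrand_eq {X Y : Type*} [NormedAddCommGroup X] [InnerProductSpace ℝ X]
    [NormedAddCommGroup Y] [InnerProductSpace ℝ Y] {p q f v t : X} {g s τ w : Y}
    (hs : s = g) (hq : q = -f) :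
    inner ℝ p (t + (0 : ℝ) • v) + inner ℝ g (τ + w) - (inner ℝ p t + inner ℝ g τ)
      - (inner ℝ s w + inner ℝ q v) = inner ℝ f v := by
  rw [hs, hq, zero_smul, add_zero, inner_add_right, inner_neg_left]
  ring

/-- For the weak solution `p` take the fields `p`, `∇p` and the traces of `p` and of `s = ∇p`. On
each element the trace terms cancel everything except `-(div s, v) = (f, v)`. -/
theorem exists_ultraweak (hΩ : IsOpen Ω) (M : Mesh Ω) {d : ℝ} (hPF : PoincareFriedrichs Ω d)
    (f : L2 Ω) : ∃ u, IsUltraweakSolution hΩ M 0 f u := by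
  obtain ⟨p, hp, s, hs1, hs2⟩ := exists_div_grad_eq hPF f
  refine ⟨(H1.fn p, H1.grad p, ⟨trGradΩ hΩ M p, p, hp, rfl⟩, ⟨trDivΩ hΩ M s, s, rfl⟩),
    fun v => ?_⟩
  refine (bform_eq_sum_of_lift hΩ M _ (p := p) rfl (s := s) rfl v).trans
    (Finset.sum_congr rfl fun i _ => ?_)
  exact ultraweak_integrand_eq (congrArg (restrL2 (M.subset i)) hs1)
    ((congrArg (restrL2 (M.subset i)) hs2).trans (map_neg _ _))

end DPG

end

/-! ### Well-posedness and quasi-optimality of the DPG scheme -/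

theorem mainTheorem5 (n : ℕ) (hn : n = 2 ∨ n = 3) (Ω : Set (DPG.Eu n))
    (hdom : DPG.IsBoundedLipschitzDomain Ω) (M : DPG.Mesh Ω) (f : DPG.L2 Ω)
    (d : ℝ) (hd : 0 < d) (hPF : DPG.PoincareFriedrichs Ω d)
    (Uh : Submodule ℝ (DPG.USp hdom.lipschitz.1 M)) (hfin : FiniteDimensional ℝ Uh) :
    (∀ w, ∃! θ, DPG.IsTrialToTest hdom.lipschitz.1 M 0 d w θ) ∧
    (∃! u, DPG.IsUltraweakSolution hdom.lipschitz.1 M 0 f u) ∧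
    (∃! uh, DPG.IsDPGSolution hdom.lipschitz.1 M 0 d f Uh uh) ∧
    ∀ u uh, DPG.IsUltraweakSolution hdom.lipschitz.1 M 0 f u →
      DPG.IsDPGSolution hdom.lipschitz.1 M 0 d f Uh uh →
      Real.sqrt ((d ^ 2)⁻¹ * ‖u.1 - uh.1‖ ^ 2 + ‖u.2.1 - uh.2.1‖ ^ 2)
        ≤ 3 * Real.sqrt 2 * ⨅ w : Uh, DPG.normU hdom.lipschitz.1 M d (u - w) := by
  have hΩ := hdom.lipschitz.1
  have hiff : ∀ w θ, DPG.IsTrialToTest hdom.lipschitz.1 M 0 d w θ ↔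
      ∀ v, inner ℝ (DPG.testEmb M d θ) (DPG.testEmb M d v) = DPG.bformₗ hΩ M 0 w v := fun w θ =>
    forall_congr' fun v => by rw [DPG.inner_testEmb, DPG.bformₗ_apply]
  have hdpg : ∀ uh, DPG.IsDPGSolution hdom.lipschitz.1 M 0 d f Uh uh ↔
      (uh ∈ Uh ∧ ∀ w ∈ Uh, ∀ θ, (∀ v, inner ℝ (DPG.testEmb M d θ) (DPG.testEmb M d v)
        = DPG.bformₗ hΩ M 0 w v) → DPG.bformₗ hΩ M 0 uh θ = DPG.load M f θ) := fun uh =>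
    and_congr_right fun _ => forall₂_congr fun w _ => forall_congr' fun θ =>
      imp_congr (hiff w θ) Iff.rfl
  have hdne := hd.ne'
  have main := fun u (hu : DPG.IsUltraweakSolution hΩ M 0 f u) =>
    DPG.abstract_dpg (DPG.testEmb M d) (DPG.testEmb_injective M hdne)
      (DPG.isClosed_range_testEmb M hdne) (DPG.bformₗ hΩ M 0)
      (fun w => Real.sqrt 3 * DPG.normU hΩ M d w)
      (fun w => mul_nonneg (Real.sqrt_nonneg _) (DPG.normU_nonneg hΩ M d w))
      (DPG.abs_bform_le hΩ M hdne) (DPG.eq_zero_of_bform_eq_zero hΩ M hd hPF)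
      (fun w => DPG.normField d w.1 w.2.1) (Real.sqrt 6) (Real.sqrt_nonneg _)
      (DPG.normField_le hΩ M hd hPF) Uh u (DPG.load M f) hu
  -- Stability constant times boundedness constant.
  have hconst : Real.sqrt 6 * Real.sqrt 3 = 3 * Real.sqrt 2 := by
    rw [show (6 : ℝ) = 3 * 2 by norm_num, Real.sqrt_mul (by norm_num), mul_right_comm,
      Real.mul_self_sqrt (by norm_num)]
  obtain ⟨u₀, hu₀⟩ := DPG.exists_ultraweak hΩ M hPF f
  obtain ⟨h1, h2, -⟩ := main u₀ hu₀
  refine ⟨fun w => ?_, ⟨u₀, hu₀, fun u hu => ?_⟩, ?_, fun u uh hu huh => ?_⟩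
  · simpa only [hiff] using h1 w
  · refine sub_eq_zero.1 (DPG.eq_zero_of_bform_eq_zero hΩ M hd hPF _ fun v => ?_)
    rw [← DPG.bformₗ_apply, map_sub, LinearMap.sub_apply, DPG.bformₗ_apply, DPG.bformₗ_apply,
      hu v, hu₀ v, sub_self]
  · simpa only [hdpg] using h2
  · rw [Real.mul_iInf_of_nonneg (by positivity)]
    refine le_ciInf fun w => ?_
    have h3 := (main u hu).2.2 uh ((hdpg uh).1 huh) w w.2
    rw [← mul_assoc, hconst] at h3
    exact h3
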